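/- **Setting.** Let $d\ge 0$, let $X\subset E^d$ be a nonempty compact convex subset of $d$-dimensional Euclidean space, and let $G$ be a finite group of isometries of $E^d$ with $g(X)=X$ for all $g\in G$. An *invariant Lipschitz bandit* on $(X,G)$ assigns to each arm $x\in X$ a probability distribution $P_x$ supported in $[0,1]$, such that the mean reward $f(x)=\int y\,dP_x(y)$ satisfies $|f(x)-f(x')|\le \|x-x'\|$ for $x,x'\in X$ and $f(g\cdot x)=f(x)$ for $g\in G$, $x\in X$. Put $f^*=\sup_X f$. **Algorithm (UniformMesh-N with inputs $n,V,\delta,G$).** Let $n\ge 2$ be the number of rounds, $\delta>0$, and $V$ a finite $\delta$-net of $X$: $V\subset X$, distinct points of $V$ are at distance $>\delta$, and every point of $X$ is at distance $\le\delta$ from some point of $V$. For $i\in V$ let $N(i,2\delta)=\{x\in V:\ \exists g\in G,\ \|g\cdot i-x\|\le 2\delta\}$. If $X_s,Y_s$ are the arm and the reward of round $s$, put for $x\in V$ $$O(x,t)=\sum_{s=1}^t \mathbb 1\{x\in N(X_s,2\delta)\},\qquad \hat f(x,t)=\frac1{O(x,t)}\sum_{s=1}^t Y_s\,\mathbb 1\{x\in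 N(X_s,2\delta)\},$$ $$U(x,t)=\hat f(x,t)+\sqrt{\frac{2\log n}{O(x,t)}}+3\delta\ \text{ if } O(x,t)\ge 1,\qquad U(x,t)=\infty \text{ if } O(x,t)=0.$$ In each round $t=1,\dots,n$ the algorithm plays some $X_t\in\arg\max_{x\in V}U(x,t-1)$, with ties broken arbitrarily (possibly at random), and receives a reward $Y_t$ whose conditional distribution given $X_1,Y_1,\dots,X_{t-1},Y_{t-1},X_t$ is $P_{X_t}$. Its regret is $\mathbf R_n=\mathbb E\big[\sum_{t=1}^n (f^*-f(X_t))\big]$. **Theorem.** For every $X$ as above and every $c>0$ there are $a_1,a_2>0$, depending only on $X$ (hence on $d$) and $c$, such that for every finite group $G$ of isometries of $E^d$ preserving $X$, every invariant Lipschitz bandit on $(X,G)$, every integer $n\ge 2$ with $n\ge c\,|G|^{2d+2}$, and every $\delta$-net $V$ of $X$ with $$\delta=\Big(\frac{\log n}{n|G|}\Big)^{\frac1{d+2}},$$ the regret of UniformMesh-N with inputs $n,V,\delta,G$ satisfies $$\mathbf R_n\le a_1\Big(\frac{\log n}{|G|}\Big)^{\frac1{d+2}}n^{\frac{d+1}{d+2}}+a_2\Big(\frac{|G|}{\log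 n}\Big)^{\frac d{d+2}}n^{\frac d{d+2}} .$$ -/

import Mathlib

open scoped MeasureTheory

noncomputable section

namespace InvariantBandit

/-- The `d`-dimensional Euclidean space. -/
abbrev E (d : ℕ) : Type := EuclideanSpace ℝ (Fin d)

/-- The symmetry group of `X`: all isometries `φ` of `E d` onto itself with `φ(X) = X`. -/
def symmetryGroup {d : ℕ} (X : Set (E d)) : Subgroup (E d ≃ᵢ E d) where
  carrier := {φ | φ '' X = X}
  mul_mem' := by
    intro a b ha hb
    change a '' X = X at ha
    change b '' X = X at hb
    change (fun x => a (b x)) '' X = X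
    rw [← Set.image_image, hb, ha]
  one_mem' := by
    change (fun x => x) '' X = X
    simp
  inv_mem' := by
    intro a ha
    change a '' X = X at ha
    change a.symm '' X = X
    conv_lhs => rw [← ha]
    rw [Set.image_image]
    simp

/-- The mean reward function of a family of reward distributions. -/
def meanReward {d : ℕ} (P : E d → MeasureTheory.Measure ℝ) (x : E d) : ℝ := ∫ y, y ∂(P x)

/-- An invariant Lipschitz bandit instance on the arm set `X`: each arm `x ∈ X` has a reward
distribution `P x` on `[0,1]`, and the mean reward is `1`-Lipschitz on `X` and `G`-invariant. -/
structure IsInvariantLipschitzBandit {d : ℕ} (X : Set (E d)) (G : Subgroup (E d ≃ᵢ E d))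
    (P : E d → MeasureTheory.Measure ℝ) : Prop where
  prob : ∀ x ∈ X, MeasureTheory.IsProbabilityMeasure (P x)
  support : ∀ x ∈ X, ∀ᵐ y ∂(P x), y ∈ Set.Icc (0 : ℝ) 1
  lipschitz : ∀ x ∈ X, ∀ x' ∈ X, |meanReward P x - meanReward P x'| ≤ dist x x'
  invariant : ∀ g ∈ G, ∀ x ∈ X, meanReward P (g x) = meanReward P x

/-- A finite `δ`-net of `X`: distinct points are more than `δ` apart, and every point of `X` is at
distance at most `δ` from the net. (Nets with the stronger covering condition `dist i x < δ` are
nets in this sense; with `≤`, every maximal `δ`-packing of a compact set is a net, so that nets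
exist for all `δ > 0`.) -/
structure IsNet {d : ℕ} (X : Set (E d)) (δ : ℝ) (V : Finset (E d)) : Prop where
  subset : ∀ i ∈ V, i ∈ X
  packing : ∀ i ∈ V, ∀ j ∈ V, i ≠ j → δ < dist i j
  covering : ∀ x ∈ X, ∃ i ∈ V, dist i x ≤ δ

/-- `N(i, ε)`: the points of the mesh `V` at distance at most `ε` from the orbit `G · i`. -/
def orbitNeighborhood {d : ℕ} (G : Subgroup (E d ≃ᵢ E d)) (V : Finset (E d)) (ε : ℝ) (i : E d) :
    Set (E d) :=
  {x | x ∈ V ∧ ∃ g ∈ G, dist (g i) x ≤ ε}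

/-! In the next three definitions, `a s` and `r s` (`s = 0, 1, …`) are the arm played and the
reward received in the `(s+1)`-st round, and the value is the one after `t` rounds. -/

open Classical in
/-- `O(x, t)`: the number of times that `x` is observed in the first `t` rounds. -/
def obsCount {d : ℕ} (G : Subgroup (E d ≃ᵢ E d)) (V : Finset (E d)) (δ : ℝ) (a : ℕ → E d)
    (x : E d) (t : ℕ) : ℕ :=
  ((Finset.range t).filter fun s => x ∈ orbitNeighborhood G V (2 * δ) (a s)).card

open Classical in
/-- The average of the rewards received in those of the first `t` rounds in which `x` is
observed (used only when `x` has been observed). -/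
def empiricalMean {d : ℕ} (G : Subgroup (E d ≃ᵢ E d)) (V : Finset (E d)) (δ : ℝ) (a : ℕ → E d)
    (r : ℕ → ℝ) (x : E d) (t : ℕ) : ℝ :=
  (∑ s ∈ (Finset.range t).filter fun s => x ∈ orbitNeighborhood G V (2 * δ) (a s), r s) /
    (obsCount G V δ a x t : ℝ)

open Classical in
/-- The index `U(x, t)`, which is `∞` as long as `x` has not been observed. -/
def ucbIndex {d : ℕ} (n : ℕ) (G : Subgroup (E d ≃ᵢ E d)) (V : Finset (E d)) (δ : ℝ)
    (a : ℕ → E d) (r : ℕ → ℝ) (x : E d) (t : ℕ) : EReal :=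
  if obsCount G V δ a x t = 0 then ⊤
  else ((empiricalMean G V δ a r x t
    + Real.sqrt (2 * Real.log n / (obsCount G V δ a x t : ℝ)) + 3 * δ : ℝ) : EReal)

/-- The information available just before the reward of the `(t+1)`-st round is drawn: all arms
played so far, the current one included, and all rewards received in earlier rounds. -/
abbrev history {d : ℕ} {Ω : Type*} (A : ℕ → Ω → E d) (Y : ℕ → Ω → ℝ) (t : ℕ) :
    MeasurableSpace Ω :=
  (⨆ s ∈ Finset.range (t + 1), MeasurableSpace.comap (A s) inferInstance) ⊔
    (⨆ s ∈ Finset.range t, MeasurableSpace.comap (Y s) inferInstance)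

/-- `A t`, `Y t` (`t < n`) are the arm and the reward of the `(t+1)`-st of `n` rounds in which the
UniformMesh-N algorithm with inputs `n, V, δ, G` plays against the reward distributions `P`:
the arm maximizes the index over `V`, ties being broken in an arbitrary, possibly random, way;
given the history, the reward is drawn from the distribution of the arm that was played. -/
structure IsUniformMeshN {d : ℕ} {Ω : Type*} [MeasurableSpace Ω] (μ : MeasureTheory.Measure Ω)
    (P : E d → MeasureTheory.Measure ℝ) (n : ℕ) (V : Finset (E d)) (δ : ℝ)
    (G : Subgroup (E d ≃ᵢ E d)) (A : ℕ → Ω → E d) (Y : ℕ → Ω → ℝ) : Prop where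
  measurable_arm : ∀ t < n, Measurable (A t)
  measurable_reward : ∀ t < n, Measurable (Y t)
  arm_mem : ∀ t < n, ∀ ω, A t ω ∈ V
  arm_max : ∀ t < n, ∀ ω, ∀ x ∈ V,
    ucbIndex n G V δ (fun s => A s ω) (fun s => Y s ω) x t ≤
      ucbIndex n G V δ (fun s => A s ω) (fun s => Y s ω) (A t ω) t
  reward_law : ∀ t < n, ∀ B : Set ℝ, MeasurableSet B →
    μ[(Y t ⁻¹' B).indicator (fun _ => (1 : ℝ)) | history A Y t] =ᵐ[μ]
      fun ω => (P (A t ω)).real B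

/-- The regret over `n` rounds: the expectation of the sum of `f* - f(X_t)`, where `f` is the
mean reward and `f*` its supremum over `X` (a maximum when `X` is compact, `f` continuous). -/
def regret {d : ℕ} {Ω : Type*} [MeasurableSpace Ω] (μ : MeasureTheory.Measure Ω) (X : Set (E d))
    (P : E d → MeasureTheory.Measure ℝ) (n : ℕ) (A : ℕ → Ω → E d) : ℝ :=
  ∫ ω, ∑ t ∈ Finset.range n, (sSup (meanReward P '' X) - meanReward P (A t ω)) ∂μ

/-- The mesh width `δ = (log n / (n |G|)) ^ (1 / (d + 2))`. -/
def meshWidth {d : ℕ} (n : ℕ) (G : Subgroup (E d ≃ᵢ E d)) : ℝ :=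
  (Real.log n / (n * Nat.card G)) ^ (1 / ((d : ℝ) + 2))

end InvariantBandit

end

namespace InvariantBandit

/-! A play of an arm also yields an observation of every mesh point within `2 * δ` of its orbit. If
the mesh is covered by few classes whose members are pairwise `2 * δ`-close up to `G`, exploration
is paid per class instead of per mesh point.

The classes come from packing in a fundamental domain (`card_le_of_separated_in_cell`). Take a point
`p` with trivial stabilizer and its Dirichlet cell. Points of a `δ`-separated set in the cell that
stay away from its walls carry small balls whose `G`-translates are all disjoint, so a volume count
bounds them by a multiple of `δ^(-d) / |G|`. The points near the walls number at most a multiple of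
`δ^(-(d-1))`, however many walls there are: sorted by one of `2d` signed coordinate directions, each
group is almost a Lipschitz graph over the other coordinates. Hence `|G| * |W| * δ^d ≤ C * (1 + |G|
* δ)`, and `n ≥ c * |G|^(2d+2)` keeps `|G| * δ` bounded.

On the event that all reward averages concentrate, optimism bounds the gap of a played arm by `5 *
δ` plus twice its confidence radius (`gap_le_of_observed`). Its observation count is at least the
number of earlier plays in its class, so summing over classes with Cauchy–Schwarz gives `5δn + |W| +
O(√(|W| n log n))`. An exponential supermartingale and a union bound make the bad event cost at most
`|V|`, of order `δ^(-d)`. The stated width makes the leading terms of order `n * δ`. -/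

/-! ### Packing in Dirichlet cells of a finite isometry group -/

theorem inner_nonpos_of_dist_le {d : ℕ} {p q w y : E d} (hw : dist w p ≤ dist w q)
    (hy : dist y q ≤ dist y p) : ∑ i, (w i - y i) * (q i - p i) ≤ 0 := by
  have h1 : dist w p ^ 2 ≤ dist w q ^ 2 := by gcongr
  have h2 : dist y q ^ 2 ≤ dist y p ^ 2 := by gcongr
  rw [EuclideanSpace.dist_eq, EuclideanSpace.dist_eq, Real.sq_sqrt (by positivity),
    Real.sq_sqrt (by positivity)] at h1 h2
  have h3 : ∑ i, (w i - y i) * (q i - p i) = ((∑ i, dist (w i) (p i) ^ 2 -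
      ∑ i, dist (w i) (q i) ^ 2) + (∑ i, dist (y i) (q i) ^ 2 - ∑ i, dist (y i) (p i) ^ 2)) / 2 := by
    rw [← Finset.sum_sub_distrib, ← Finset.sum_sub_distrib, ← Finset.sum_add_distrib,
      Finset.sum_div]
    refine Finset.sum_congr rfl fun i _ => ?_
    simp only [Real.dist_eq, sq_abs]
    ring
  rw [h3]
  linarith

/-- Take `j` to be a coordinate where `|u j|` is largest and divide the half-space inequality by `|u
j|`: the other coefficients are then at most `1` in absolute value. -/
theorem exists_signed_coord_le_sum {d : ℕ} {u : E d} (hu : u ≠ 0) :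
    ∃ j : Fin d, ∃ s : ℝ, (s = 1 ∨ s = -1) ∧ ∀ z : Fin d → ℝ, ∑ i, z i * u i ≤ 0 →
      s * z j ≤ ∑ i ∈ Finset.univ.erase j, |z i| := by
  have hne : ∃ i, u i ≠ 0 := by
    by_contra! h
    exact hu (by ext i; simpa using h i)
  obtain ⟨i₀, hi₀⟩ := hne
  obtain ⟨j, -, hj⟩ := Finset.exists_max_image Finset.univ (fun i => |u i|) ⟨i₀, Finset.mem_univ _⟩
  have hpos : 0 < |u j| := (abs_pos.2 hi₀).trans_le (hj i₀ (Finset.mem_univ _))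
  have key : ∀ s : ℝ, s * |u j| = u j → ∀ z : Fin d → ℝ, ∑ i, z i * u i ≤ 0 →
      s * z j ≤ ∑ i ∈ Finset.univ.erase j, |z i| := by
    intro s hs z hz
    rw [← Finset.add_sum_erase _ _ (Finset.mem_univ j)] at hz
    have h1 : -(∑ i ∈ Finset.univ.erase j, z i * u i) ≤
        ∑ i ∈ Finset.univ.erase j, |z i| * |u j| := by
      rw [← Finset.sum_neg_distrib]
      refine Finset.sum_le_sum fun i _ => ?_
      calc -(z i * u i) ≤ |z i * u i| := neg_le_abs _
        _ = |z i| * |u i| := abs_mul _ _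
        _ ≤ _ := mul_le_mul_of_nonneg_left (hj i (Finset.mem_univ _)) (abs_nonneg _)
    rw [← Finset.sum_mul] at h1
    refine le_of_mul_le_mul_right ?_ hpos
    have : s * z j * |u j| = z j * u j := by rw [← hs]; ring_nf; simp [hs]
    linarith
  rcases le_total 0 (u j) with h | h
  · exact ⟨j, 1, Or.inl rfl, key 1 (by simp [abs_of_nonneg h])⟩
  · exact ⟨j, -1, Or.inr rfl, key (-1) (by simp [abs_of_nonpos h])⟩

theorem abs_coord_sub_le_dist {d : ℕ} (x y : E d) (i : Fin d) : |x i - y i| ≤ dist x y := by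
  rw [dist_eq_norm]
  simpa using PiLp.norm_apply_le (x - y) i

theorem dist_le_sum_abs {d : ℕ} (x y : E d) : dist x y ≤ ∑ i, |x i - y i| := by
  rw [EuclideanSpace.dist_eq]
  refine Real.sqrt_le_iff.2 ⟨by positivity, ?_⟩
  exact Finset.sum_sq_le_sq_sum_of_nonneg (fun i _ => abs_nonneg _)

/-- A point near a bisector that bounds a cell: in some signed coordinate direction, the cell does
not extend far beyond it. -/
theorem exists_facet_direction {d : ℕ} {p q y : E d} (hpq : p ≠ q) (hy : dist y q ≤ dist y p)
    (w : E d) : ∃ j : Fin d, ∃ s : ℝ, (s = 1 ∨ s = -1) ∧ ∀ w' : E d, dist w' p ≤ dist w' q →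
      s * (w' j - w j) ≤ ∑ i ∈ Finset.univ.erase j, |w' i - w i| + d * dist w y := by
  obtain ⟨j, s, hs, h⟩ := exists_signed_coord_le_sum (sub_ne_zero.2 hpq.symm)
  refine ⟨j, s, hs, fun w' hw' => ?_⟩
  have h1 := h (fun i => w' i - y i) (by simpa using inner_nonpos_of_dist_le hw' hy)
  have h2 : ∑ i ∈ Finset.univ.erase j, |w' i - y i| ≤
      ∑ i ∈ Finset.univ.erase j, |w' i - w i| + ∑ i ∈ Finset.univ.erase j, |w i - y i| := by
    rw [← Finset.sum_add_distrib]
    exact Finset.sum_le_sum fun i _ => abs_sub_le _ _ _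
  have h3 : |w j - y j| + ∑ i ∈ Finset.univ.erase j, |w i - y i| ≤ d * dist w y := by
    rw [Finset.add_sum_erase _ (fun i => |w i - y i|) (Finset.mem_univ j)]
    calc _ ≤ ∑ i : Fin d, dist w y := Finset.sum_le_sum fun i _ => abs_coord_sub_le_dist w y i
      _ = _ := by simp
  have h4 : s * (y j - w j) ≤ |w j - y j| := by
    rcases hs with rfl | rfl
    · rw [abs_sub_comm]; simpa using le_abs_self (y j - w j)
    · simpa using le_abs_self (w j - y j)
  simp only at h1
  have : s * (w' j - w j) = s * (w' j - y j) + s * (y j - w j) := by ring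
  linarith

/-- Under `h`, nearness in the coordinates other than `j` forces nearness in coordinate `j`. A
separated set is therefore counted by a grid in `d - 1` dimensions. -/
theorem card_le_of_common_direction {d : ℕ} {S : Finset (E d)} {R δ : ℝ} (hR0 : 0 ≤ R) (hδ : 0 < δ)
    (hR : ∀ w ∈ S, ‖w‖ ≤ R) (hsep : ∀ w ∈ S, ∀ w' ∈ S, w ≠ w' → δ < dist w w')
    (j : Fin d) (s : ℝ) (hs : s = 1 ∨ s = -1)
    (h : ∀ w ∈ S, ∀ w' ∈ S,
      s * (w' j - w j) ≤ ∑ i ∈ Finset.univ.erase j, |w' i - w i| + δ / 4) :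
    (S.card : ℝ) ≤ (2 * (4 * (d + 1) * R / δ + 1) + 1) ^ (d - 1) := by
  set K : ℝ := 4 * (d + 1) / δ with hK
  have hKpos : 0 < K := by positivity
  set M : ℕ := ⌈K * R⌉₊ with hM
  let T : Finset (Fin d → ℤ) := Fintype.piFinset fun i =>
    if i = j then {0} else Finset.Icc (-(M : ℤ)) M
  have hT : T.card = (2 * M + 1) ^ (d - 1) := by
    rw [Fintype.card_piFinset, ← Finset.mul_prod_erase _ _ (Finset.mem_univ j),
      Finset.prod_congr rfl (g := fun _ => 2 * M + 1)]
    · simp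
    · intro i hi
      rw [if_neg (Finset.ne_of_mem_erase hi), Int.card_Icc]
      omega
  have hcard : S.card ≤ T.card := by
    refine Finset.card_le_card_of_injOn (fun w i => if i = j then 0 else ⌊K * w i⌋) ?_ ?_
    · intro w hw
      simp only [T, Finset.mem_coe, Fintype.mem_piFinset]
      intro i
      by_cases hi : i = j
      · simp [hi]
      · simp only [hi, if_false, Finset.mem_Icc]
        have h1 : |w i| ≤ R := (by simpa using PiLp.norm_apply_le w i : |w i| ≤ ‖w‖).trans (hR w hw)
        have h2 : K * R ≤ M := Nat.le_ceil _
        have h3 := abs_le.1 h1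
        constructor
        · rw [Int.le_floor]; push_cast; nlinarith
        · have : (⌊K * w i⌋ : ℝ) ≤ M := (Int.floor_le _).trans (by nlinarith)
          exact_mod_cast this
    -- Equal floors put the other coordinates within `δ / 4` in total; `h` used both ways puts
    -- coordinate `j` within `δ / 2`. The distance is then at most `3δ/4`, against separation.
    · intro w hw w' hw' heq
      by_contra hne
      have hc : ∀ i ∈ Finset.univ.erase j, |w' i - w i| ≤ δ / (4 * (d + 1)) := by
        intro i hi
        have h1 := congrFun heq i
        simp only [Finset.ne_of_mem_erase hi, if_false] at h1
        have h2 := (Int.abs_sub_lt_one_of_floor_eq_floor h1.symm).le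
        rw [← mul_sub, abs_mul, abs_of_pos hKpos, ← le_div_iff₀' hKpos] at h2
        simpa [hK] using h2
      have hsum : ∑ i ∈ Finset.univ.erase j, |w' i - w i| ≤ δ / 4 := by
        refine (Finset.sum_le_card_nsmul _ _ _ hc).trans ?_
        rw [Finset.card_erase_of_mem (Finset.mem_univ j), nsmul_eq_mul, Finset.card_univ,
          Fintype.card_fin, mul_div_assoc', div_le_div_iff₀ (by positivity) (by norm_num)]
        have : ((d - 1 : ℕ) : ℝ) ≤ d + 1 := by
          have : d - 1 ≤ d + 1 := by omega
          exact_mod_cast this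
        nlinarith
      have hj : |w' j - w j| ≤ δ / 2 := by
        have h1 := h w hw w' hw'
        have h2 := h w' hw' w hw
        simp_rw [abs_sub_comm (w _) (w' _)] at h2
        rw [abs_le]
        rcases hs with rfl | rfl <;> constructor <;> linarith
      have h3 := dist_le_sum_abs w' w
      rw [← Finset.add_sum_erase _ _ (Finset.mem_univ j)] at h3
      have h4 := hsep w' hw' w hw (Ne.symm hne)
      linarith
  calc (S.card : ℝ) ≤ T.card := by exact_mod_cast hcard
    _ = (2 * (M : ℝ) + 1) ^ (d - 1) := by rw [hT]; push_cast; rfl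
    _ ≤ _ := by
      gcongr
      have := (Nat.ceil_lt_add_one (show 0 ≤ K * R by positivity)).le
      refine this.trans (le_of_eq ?_)
      rw [hK]; ring

/-- Isometries are affine, so each `g ≠ 1` fixes a proper affine subspace, a null set; finitely many
of these do not fill the space. -/
theorem exists_trivial_stabilizer {d : ℕ} (G : Subgroup (E d ≃ᵢ E d)) [Finite G] :
    ∃ p : E d, ∀ g ∈ G, g p = p → g = 1 := by
  let F : (E d ≃ᵢ E d) → AffineSubspace ℝ (E d) := fun g =>
    { carrier := {x | g x = x}
      smul_vsub_vadd_mem' := by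
        intro c p₁ p₂ p₃ h₁ h₂ h₃
        rw [← g.coeFn_toRealAffineIsometryEquiv] at h₁ h₂ h₃ ⊢
        simp only [Set.mem_ofPred_eq] at h₁ h₂ h₃ ⊢
        rw [AffineIsometryEquiv.map_vadd, map_smul, AffineIsometryEquiv.map_vsub, h₁, h₂, h₃] }
  have hnull : ∀ g : E d ≃ᵢ E d, g ≠ 1 → MeasureTheory.volume (F g : Set (E d)) = 0 := by
    intro g hg
    refine MeasureTheory.Measure.addHaar_affineSubspace _ _ fun htop => hg ?_
    ext1 x
    have : x ∈ F g := htop ▸ AffineSubspace.mem_top ℝ (E d) x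
    exact this
  have hU : MeasureTheory.volume (⋃ g ∈ {g : G | g ≠ 1}, (F g : Set (E d))) = 0 := by
    rw [MeasureTheory.measure_biUnion_null_iff (Set.to_countable _)]
    exact fun g hg => hnull g (by simpa using hg)
  have hne : (⋃ g ∈ {g : G | g ≠ 1}, (F g : Set (E d))) ≠ Set.univ := by
    intro h
    rw [h] at hU
    exact (NeZero.ne (MeasureTheory.volume : MeasureTheory.Measure (E d)))
      (MeasureTheory.Measure.measure_univ_eq_zero.1 hU)
  obtain ⟨p, hp⟩ := (Set.ne_univ_iff_exists_notMem _).1 hne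
  refine ⟨p, fun g hg hgp => ?_⟩
  by_contra hne
  refine hp (Set.mem_iUnion₂.2 ⟨⟨g, hg⟩, fun h => hne (congrArg Subtype.val h), hgp⟩)

/-- The closed Dirichlet cell of `p` with respect to the orbit `G · p`. -/
noncomputable def dirichletCell {d : ℕ} (G : Subgroup (E d ≃ᵢ E d)) (p : E d) : Set (E d) :=
  {x | ∀ g ∈ G, dist x p ≤ dist x (g p)}

/-- Choose `g` bringing `x` closest to `p`. -/
theorem exists_mem_dirichletCell {d : ℕ} (G : Subgroup (E d ≃ᵢ E d)) [Finite G] (p x : E d) :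
    ∃ g ∈ G, g x ∈ dirichletCell G p := by
  obtain ⟨g, hg⟩ := Finite.exists_min fun g : G => dist ((g : E d ≃ᵢ E d) x) p
  refine ⟨g, g.2, fun h hh => (hg (⟨h, hh⟩⁻¹ * g)).trans (le_of_eq ?_)⟩
  rw [← h.dist_eq]
  change dist (h (h⁻¹ ((g : E d ≃ᵢ E d) x))) (h p) = _
  rw [IsometryEquiv.apply_inv_self]

/-- Points whose small balls lie in the open Dirichlet cell. -/
theorem card_le_of_ball_subset_cell {d : ℕ} {G : Subgroup (E d ≃ᵢ E d)} [Finite G] {p : E d}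
    {S : Finset (E d)} {R r : ℝ} (hR : 0 ≤ R) (hr : 0 < r) (hr1 : r ≤ 1)
    (hSR : ∀ w ∈ S, ∀ g ∈ G, ‖g w‖ ≤ R)
    (hsep : ∀ w ∈ S, ∀ w' ∈ S, w ≠ w' → 2 * r ≤ dist w w')
    (hball : ∀ w ∈ S, ∀ y, dist w y < r → ∀ g ∈ G, g ≠ 1 → dist y p < dist y (g p)) :
    (Nat.card G : ℝ) * S.card * r ^ d ≤ (R + 1) ^ d := by
  have := Fintype.ofFinite G
  have hdisj : Set.PairwiseDisjoint (↑((Finset.univ : Finset G) ×ˢ S) : Set (G × E d))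
      (fun q => Metric.ball ((q.1 : E d ≃ᵢ E d) q.2) r) := by
    rintro ⟨g, w⟩ hgw ⟨h, w'⟩ hhw hne
    simp only [Finset.coe_product, Set.mem_prod, Finset.mem_coe] at hgw hhw
    by_cases hgh : g = h
    · subst hgh
      refine Metric.ball_disjoint_ball ?_
      change r + r ≤ dist ((g : E d ≃ᵢ E d) w) ((g : E d ≃ᵢ E d) w')
      rw [IsometryEquiv.dist_eq]
      have := hsep w hgw.2 w' hhw.2 (fun h => hne (by rw [h]))
      linarith
    · refine Set.disjoint_left.2 fun y hy hy' => ?_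
      simp only [Metric.mem_ball] at hy hy'
      -- A point of the ball around `g w` is strictly closer to `g p` than to any other `h p`; two
      -- different translates cannot share it.
      have key : ∀ (g h : G) (w : E d), w ∈ S → g ≠ h → dist y ((g : E d ≃ᵢ E d) w) < r →
          dist y ((g : E d ≃ᵢ E d) p) < dist y ((h : E d ≃ᵢ E d) p) := by
        intro g h w hw hgh hy
        have e : ∀ z, dist ((g : E d ≃ᵢ E d)⁻¹ y) z = dist y ((g : E d ≃ᵢ E d) z) := by
          intro z
          rw [← (g : E d ≃ᵢ E d).dist_eq, IsometryEquiv.apply_inv_self]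
        have h1 := hball w hw ((g : E d ≃ᵢ E d)⁻¹ y) (by rwa [dist_comm, e]) (g⁻¹ * h : G)
          (g⁻¹ * h).2 (by
            intro h1
            have h2 : g⁻¹ * h = 1 := Subtype.ext h1
            exact hgh (inv_mul_eq_one.1 h2))
        have h3 : ((g⁻¹ * h : G) : E d ≃ᵢ E d) p =
          (g : E d ≃ᵢ E d)⁻¹ ((h : E d ≃ᵢ E d) p) := rfl
        rwa [h3, e, e, IsometryEquiv.apply_inv_self] at h1
      exact lt_asymm (key g h w hgw.2 hgh hy) (key h g w' hhw.2 (Ne.symm hgh) hy')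
  have hvol : MeasureTheory.volume (⋃ q ∈ (Finset.univ : Finset G) ×ˢ S,
      Metric.ball ((q.1 : E d ≃ᵢ E d) q.2) r) ≤
        MeasureTheory.volume (Metric.ball (0 : E d) (R + 1)) := by
    refine MeasureTheory.measure_mono (Set.iUnion₂_subset fun q hq => ?_)
    refine Metric.ball_subset_ball' ?_
    have := hSR q.2 (Finset.mem_product.1 hq).2 q.1 q.1.2
    rw [dist_zero_right]
    linarith
  rw [MeasureTheory.measure_biUnion_finset hdisj fun _ _ => Metric.isOpen_ball.measurableSet] at hvol
  simp_rw [MeasureTheory.Measure.addHaar_ball_of_pos MeasureTheory.volume _ hr,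
    MeasureTheory.Measure.addHaar_ball_of_pos MeasureTheory.volume _
      (show 0 < R + 1 by linarith)] at hvol
  rw [Finset.sum_const, nsmul_eq_mul, ← mul_assoc, ENNReal.mul_le_mul_iff_left
    (Metric.measure_ball_pos _ _ one_pos).ne' MeasureTheory.measure_ball_lt_top.ne,
    ← ENNReal.ofReal_natCast, ← ENNReal.ofReal_mul (by positivity),
    ENNReal.ofReal_le_ofReal_iff (by positivity)] at hvol
  simpa [Finset.card_product, Nat.card_eq_fintype_card] using hvol

/-- The whole cell lies on the side of `p` of each bisector, so the direction attached to `w`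
constrains every other `w'` in `S`. Sorting by the `2 * d` signed directions, not by the walls,
keeps the bound independent of `G`. -/
theorem card_le_of_near_facet {d : ℕ} {G : Subgroup (E d ≃ᵢ E d)} {p : E d}
    (hp : ∀ g ∈ G, g p = p → g = 1) {S : Finset (E d)} {R δ : ℝ} (hR0 : 0 ≤ R) (hδ : 0 < δ)
    (hSR : ∀ w ∈ S, ‖w‖ ≤ R) (hsep : ∀ w ∈ S, ∀ w' ∈ S, w ≠ w' → δ < dist w w')
    (hcell : ∀ w ∈ S, w ∈ dirichletCell G p)
    (hnear : ∀ w ∈ S, ∃ y, dist w y < δ / (4 * (d + 1)) ∧ ∃ g ∈ G, g ≠ 1 ∧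
      dist y (g p) ≤ dist y p) :
    (S.card : ℝ) ≤ 2 * d * (2 * (4 * (d + 1) * R / δ + 1) + 1) ^ (d - 1) := by
  classical
  have hdir : ∀ w ∈ S, ∃ a : Fin d × Bool, ∀ w' ∈ S, (if a.2 then 1 else -1) * (w' a.1 - w a.1) ≤
      ∑ i ∈ Finset.univ.erase a.1, |w' i - w i| + δ / 4 := by
    intro w hw
    obtain ⟨y, hy, g, hg, hg1, hyg⟩ := hnear w hw
    obtain ⟨j, s, hs, h⟩ := exists_facet_direction (p := p) (q := g p)
      (fun h => hg1 (hp g hg h.symm)) hyg w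
    have hd : d * dist w y ≤ δ / 4 := by
      rw [lt_div_iff₀ (by positivity)] at hy
      have := dist_nonneg (x := w) (y := y)
      nlinarith
    refine ⟨(j, decide (s = 1)), fun w' hw' => ?_⟩
    have h1 := h w' (hcell w' hw' g hg)
    rcases hs with rfl | rfl
    · simp only [decide_true, if_true]
      linarith
    · have : ¬ ((-1 : ℝ) = 1) := by norm_num
      simp only [this, decide_false, Bool.false_eq_true, if_false]
      linarith
  rcases S.eq_empty_or_nonempty with rfl | ⟨w₀, hw₀⟩
  · simp only [Finset.card_empty, Nat.cast_zero]
    positivity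
  have : Nonempty (Fin d × Bool) := ⟨(hdir w₀ hw₀).choose⟩
  choose! a ha using hdir
  have hfib : ∀ b ∈ (Finset.univ : Finset (Fin d × Bool)),
      ((S.filter fun w => a w = b).card : ℝ) ≤ (2 * (4 * (d + 1) * R / δ + 1) + 1) ^ (d - 1) := by
    intro b _
    refine card_le_of_common_direction hR0 hδ (fun w hw => hSR w (Finset.mem_filter.1 hw).1)
      (fun w hw w' hw' => hsep w (Finset.mem_filter.1 hw).1 w' (Finset.mem_filter.1 hw').1)
      b.1 (if b.2 then 1 else -1) (by cases b.2 <;> simp) ?_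
    intro w hw w' hw'
    rw [Finset.mem_filter] at hw hw'
    have := ha w hw.1 w' hw'.1
    rwa [hw.2] at this
  rw [Finset.card_eq_sum_card_fiberwise (f := a) (t := Finset.univ) (fun _ _ => Finset.mem_univ _)]
  push_cast
  refine (Finset.sum_le_sum hfib).trans (le_of_eq ?_)
  simp only [Finset.sum_const, Finset.card_univ, Fintype.card_prod, Fintype.card_fin,
    Fintype.card_bool, nsmul_eq_mul]
  push_cast
  ring

/-- The constant in the packing bound for Dirichlet cells. -/
noncomputable def packingConst (d : ℕ) (R : ℝ) : ℝ :=
  (4 * (d + 1)) ^ d * (R + 1) ^ d + 2 * d * (8 * (d + 1) * R + 3) ^ (d - 1)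

theorem packingConst_nonneg (d : ℕ) {R : ℝ} (hR : 0 ≤ R) : 0 ≤ packingConst d R := by
  unfold packingConst
  positivity

theorem card_le_of_separated_in_cell {d : ℕ} {G : Subgroup (E d ≃ᵢ E d)} [Finite G] {p : E d}
    (hp : ∀ g ∈ G, g p = p → g = 1) {S : Finset (E d)} {R δ : ℝ} (hR0 : 0 ≤ R) (hδ : 0 < δ)
    (hδ1 : δ ≤ 1) (hSR : ∀ w ∈ S, ∀ g ∈ G, ‖g w‖ ≤ R)
    (hsep : ∀ w ∈ S, ∀ w' ∈ S, w ≠ w' → δ < dist w w')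
    (hcell : ∀ w ∈ S, w ∈ dirichletCell G p) :
    (Nat.card G : ℝ) * S.card * δ ^ d ≤ packingConst d R * (1 + Nat.card G * δ) := by
  classical
  let Q : E d → Prop := fun w => ∃ y, dist w y < δ / (4 * (d + 1)) ∧ ∃ g ∈ G, g ≠ 1 ∧
      dist y (g p) ≤ dist y p
  have hd4 : (1 : ℝ) ≤ 4 * (d + 1) := by nlinarith [Nat.cast_nonneg (α := ℝ) d]
  have hbad : (Nat.card G : ℝ) * (S.filter Q).card * δ ^ d ≤
      2 * d * (8 * (d + 1) * R + 3) ^ (d - 1) * (Nat.card G * δ) := by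
    have h1 := card_le_of_near_facet hp (S := S.filter Q) hR0 hδ
      (fun w hw => by simpa using hSR w (Finset.mem_filter.1 hw).1 1 G.one_mem)
      (fun w hw w' hw' => hsep w (Finset.mem_filter.1 hw).1 w' (Finset.mem_filter.1 hw').1)
      (fun w hw => hcell w (Finset.mem_filter.1 hw).1) (fun w hw => (Finset.mem_filter.1 hw).2)
    have h2 : 2 * d * (2 * (4 * (d + 1) * R / δ + 1) + 1) ^ (d - 1) * δ ^ d ≤
        2 * d * (8 * (d + 1) * R + 3) ^ (d - 1) * δ := by
      -- For `d = 0` the factor `2 * d` vanishes, so the truncated exponent `d - 1` is harmless.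
      rcases d with _ | k
      · simp
      · rw [Nat.add_sub_cancel, pow_succ δ, mul_assoc, ← mul_assoc (_ ^ k), ← mul_pow, ← mul_assoc]
        gcongr
        rw [add_mul, mul_add, add_mul, mul_div_assoc', div_mul_cancel₀ _ hδ.ne']
        linarith
    calc _ = Nat.card G * ((S.filter Q).card * δ ^ d) := by ring
      _ ≤ Nat.card G * (2 * d * (2 * (4 * (d + 1) * R / δ + 1) + 1) ^ (d - 1) * δ ^ d) := by gcongr
      _ ≤ Nat.card G * (2 * d * (8 * (d + 1) * R + 3) ^ (d - 1) * δ) := by gcongr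
      _ = _ := by ring
  have hgood : (Nat.card G : ℝ) * (S.filter fun w => ¬ Q w).card * δ ^ d ≤
      (4 * (d + 1)) ^ d * (R + 1) ^ d := by
    have h1 := card_le_of_ball_subset_cell (G := G) (p := p) (S := S.filter fun w => ¬ Q w) (R := R)
      (r := δ / (4 * (d + 1))) hR0 (by positivity) ((div_le_self hδ.le hd4).trans hδ1)
      (fun w hw => hSR w (Finset.mem_filter.1 hw).1)
      (fun w hw w' hw' hne => by
        refine le_trans ?_ (hsep w (Finset.mem_filter.1 hw).1 w' (Finset.mem_filter.1 hw').1 hne).le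
        rw [mul_div_assoc', div_le_iff₀ (by positivity)]
        nlinarith [mul_nonneg hδ.le (Nat.cast_nonneg (α := ℝ) d)])
      (fun w hw y hy g hg hg1 => by
        by_contra! h
        exact (Finset.mem_filter.1 hw).2 ⟨y, hy, g, hg, hg1, h⟩)
    rw [div_pow, mul_div_assoc', div_le_iff₀ (by positivity)] at h1
    linarith
  have hsum : (S.card : ℝ) = (S.filter Q).card + (S.filter fun w => ¬ Q w).card := by
    exact_mod_cast (Finset.card_filter_add_card_filter_not Q).symm
  have hA : 0 ≤ (4 * (d + 1 : ℝ)) ^ d * (R + 1) ^ d := by positivity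
  have hB : 0 ≤ 2 * d * (8 * (d + 1) * R + 3) ^ (d - 1) := by positivity
  have hC : 0 ≤ Nat.card G * δ := by positivity
  rw [hsum, packingConst]
  nlinarith [mul_nonneg hA hC]

/-- The trivial group, whose Dirichlet cell is the whole space. -/
theorem card_mul_pow_le_of_separated {d : ℕ} {S : Finset (E d)} {R δ : ℝ} (hR0 : 0 ≤ R)
    (hδ : 0 < δ) (hδ1 : δ ≤ 1) (hSR : ∀ w ∈ S, ‖w‖ ≤ R)
    (hsep : ∀ w ∈ S, ∀ w' ∈ S, w ≠ w' → δ < dist w w') :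
    (S.card : ℝ) * δ ^ d ≤ 2 * packingConst d R := by
  have h := card_le_of_separated_in_cell (G := ⊥) (p := (0 : E d)) (S := S) (R := R)
    (fun g hg _ => Subgroup.mem_bot.1 hg) hR0 hδ hδ1
    (fun w hw g hg => by rw [Subgroup.mem_bot.1 hg]; simpa using hSR w hw) hsep
    (fun w _ g hg => by rw [Subgroup.mem_bot.1 hg]; simp)
  rw [Subgroup.card_bot] at h
  have := packingConst_nonneg d hR0
  simp only [Nat.cast_one, one_mul] at h
  nlinarith

/-- A cover of `V` by few classes, any two members of which are `2δ`-close up to the group. -/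
theorem exists_orbit_clique_cover {d : ℕ} {X : Set (E d)} {G : Subgroup (E d ≃ᵢ E d)} [Finite G]
    (hG : G ≤ symmetryGroup X) {R δ : ℝ} (hR0 : 0 ≤ R) (hR : ∀ x ∈ X, ‖x‖ ≤ R) (hδ : 0 < δ)
    (hδ1 : δ ≤ 1) (V : Finset (E d)) (hV : ∀ v ∈ V, v ∈ X) :
    ∃ (W : Finset (E d)) (κ : E d → E d), (∀ v ∈ V, κ v ∈ W) ∧
      (∀ v ∈ V, ∀ v' ∈ V, κ v = κ v' → ∃ g ∈ G, dist (g v) v' ≤ 2 * δ) ∧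
      (Nat.card G : ℝ) * W.card * δ ^ d ≤ packingConst d R * (1 + Nat.card G * δ) := by
  classical
  obtain ⟨p, hp⟩ := exists_trivial_stabilizer G
  have hGX : ∀ g ∈ G, ∀ x ∈ X, g x ∈ X := by
    intro g hg x hx
    have h : g '' X = X := hG hg
    exact h ▸ Set.mem_image_of_mem g hx
  choose ρ hρG hρ using exists_mem_dirichletCell G p
  let V' := V.image fun v => ρ v v
  let F := V'.powerset.filter fun S => ∀ w ∈ S, ∀ w' ∈ S, w ≠ w' → δ < dist w w'
  -- Transport into the cell can bring mesh points close together, so a maximal `δ`-separated subset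
  -- is selected afresh; by maximality it is within `δ` of every transported point.
  obtain ⟨W, hWF, hmax⟩ := Finset.exists_max_image F Finset.card ⟨∅, by simp [F]⟩
  obtain ⟨hWV, hsep⟩ := Finset.mem_filter.1 hWF
  rw [Finset.mem_powerset] at hWV
  have hnear : ∀ v ∈ V, ∃ w ∈ W, dist (ρ v v) w ≤ δ := by
    intro v hv
    by_contra! h
    have hnot : ρ v v ∉ W := fun hmem => by
      have := h _ hmem
      rw [dist_self] at this
      exact lt_asymm this hδ
    have hins : insert (ρ v v) W ∈ F := by
      refine Finset.mem_filter.2 ⟨Finset.mem_powerset.2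
        (Finset.insert_subset (Finset.mem_image_of_mem _ hv) hWV), ?_⟩
      intro w hw w' hw' hne
      rcases Finset.mem_insert.1 hw with rfl | hw <;> rcases Finset.mem_insert.1 hw' with rfl | hw'
      · exact absurd rfl hne
      · exact h _ hw'
      · rw [dist_comm]; exact h _ hw
      · exact hsep w hw w' hw' hne
    have := hmax _ hins
    rw [Finset.card_insert_of_notMem hnot] at this
    omega
  choose! κ hκW hκ using hnear
  refine ⟨W, κ, hκW, ?_, ?_⟩
  · intro v hv v' hv' heq
    refine ⟨(ρ v')⁻¹ * ρ v, G.mul_mem (G.inv_mem (hρG v')) (hρG v), ?_⟩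
    have h1 : dist (((ρ v')⁻¹ * ρ v : E d ≃ᵢ E d) v) v' = dist (ρ v v) (ρ v' v') := by
      rw [← (ρ v').dist_eq]
      change dist (ρ v' ((ρ v')⁻¹ (ρ v v))) _ = _
      rw [IsometryEquiv.apply_inv_self]
    rw [h1]
    have h2 := hκ v hv
    have h3 := hκ v' hv'
    rw [← heq] at h3
    have := dist_triangle_right (ρ v v) (ρ v' v') (κ v)
    linarith
  · have hmem : ∀ w ∈ W, ∃ v ∈ V, ρ v v = w := fun w hw => Finset.mem_image.1 (hWV hw)
    refine card_le_of_separated_in_cell hp hR0 hδ hδ1 ?_ hsep ?_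
    · intro w hw g hg
      obtain ⟨v, hv, rfl⟩ := hmem w hw
      exact hR _ (hGX g hg _ (hGX _ (hρG v) _ (hV v hv)))
    · intro w hw
      obtain ⟨v, hv, rfl⟩ := hmem w hw
      exact hρ v

/-! ### Regret of a single run on the good event -/

theorem meanReward_mem_Icc {d : ℕ} {X : Set (E d)} {G : Subgroup (E d ≃ᵢ E d)}
    {P : E d → MeasureTheory.Measure ℝ} (hP : IsInvariantLipschitzBandit X G P) {x : E d}
    (hx : x ∈ X) : meanReward P x ∈ Set.Icc (0 : ℝ) 1 := by
  have := hP.prob x hx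
  have hint : MeasureTheory.Integrable (fun y : ℝ => y) (P x) :=
    MeasureTheory.Integrable.of_mem_Icc 0 1 aemeasurable_id (hP.support x hx)
  constructor
  · exact MeasureTheory.integral_nonneg_of_ae ((hP.support x hx).mono fun y hy => hy.1)
  · calc meanReward P x ≤ ∫ _, (1 : ℝ) ∂(P x) := MeasureTheory.integral_mono_ae hint
          (MeasureTheory.integrable_const _) ((hP.support x hx).mono fun y hy => hy.2)
      _ = 1 := by simp

theorem gap_mem_Icc {d : ℕ} {X : Set (E d)} {G : Subgroup (E d ≃ᵢ E d)}
    {P : E d → MeasureTheory.Measure ℝ} (hP : IsInvariantLipschitzBandit X G P) {x : E d}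
    (hx : x ∈ X) : sSup (meanReward P '' X) - meanReward P x ∈ Set.Icc (0 : ℝ) 1 := by
  have hub : ∀ y ∈ meanReward P '' X, y ≤ 1 := by
    rintro _ ⟨z, hz, rfl⟩
    exact (meanReward_mem_Icc hP hz).2
  have h1 := le_csSup ⟨1, hub⟩ (Set.mem_image_of_mem _ hx)
  have h2 := csSup_le ⟨_, Set.mem_image_of_mem _ hx⟩ hub
  have h3 := (meanReward_mem_Icc hP hx).1
  exact ⟨by linarith, by linarith⟩

theorem exists_net_near_sup {d : ℕ} {X : Set (E d)} {G : Subgroup (E d ≃ᵢ E d)}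
    {P : E d → MeasureTheory.Measure ℝ} (hP : IsInvariantLipschitzBandit X G P) (hX : X.Nonempty)
    {δ : ℝ} {V : Finset (E d)} (hV : IsNet X δ V) :
    ∃ x ∈ V, sSup (meanReward P '' X) ≤ meanReward P x + δ := by
  obtain ⟨x₀, hx₀⟩ := hX
  obtain ⟨v₀, hv₀, -⟩ := hV.covering x₀ hx₀
  obtain ⟨x, hx, hmax⟩ := Finset.exists_max_image V (meanReward P) ⟨v₀, hv₀⟩
  refine ⟨x, hx, csSup_le ⟨_, Set.mem_image_of_mem _ hx₀⟩ ?_⟩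
  rintro _ ⟨z, hz, rfl⟩
  obtain ⟨v, hv, hvz⟩ := hV.covering z hz
  have h1 := hP.lipschitz v (hV.subset v hv) z hz
  have h2 := hmax v hv
  have h3 := (abs_le.1 h1).1
  linarith

/-- The sum of the centred rewards in those of the first `t` rounds in which `x` is observed. -/
noncomputable def noiseSum {d : ℕ} (P : E d → MeasureTheory.Measure ℝ) (G : Subgroup (E d ≃ᵢ E d))
    (V : Finset (E d)) (δ : ℝ) (a : ℕ → E d) (r : ℕ → ℝ) (x : E d) (t : ℕ) : ℝ :=
  ∑ s ∈ Finset.range t,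
    (orbitNeighborhood G V (2 * δ) (a s)).indicator (fun _ => r s - meanReward P (a s)) x

/-- The bias is at most `2 * δ` by invariance and the Lipschitz condition; the noise is `noiseSum`
divided by the count. -/
theorem abs_empiricalMean_sub_le {d : ℕ} {X : Set (E d)} {G : Subgroup (E d ≃ᵢ E d)}
    (hG : G ≤ symmetryGroup X) {P : E d → MeasureTheory.Measure ℝ}
    (hP : IsInvariantLipschitzBandit X G P) {V : Finset (E d)} (hV : ∀ v ∈ V, v ∈ X) {δ : ℝ}
    {a : ℕ → E d} {r : ℕ → ℝ} {x : E d} (hx : x ∈ V) {t : ℕ} (ha : ∀ s < t, a s ∈ V) {L : ℝ}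
    (hO : obsCount G V δ a x t ≠ 0)
    (hgood : |noiseSum P G V δ a r x t| ≤ Real.sqrt (L * obsCount G V δ a x t)) :
    |empiricalMean G V δ a r x t - meanReward P x| ≤
      2 * δ + Real.sqrt (L / obsCount G V δ a x t) := by
  classical
  set O := obsCount G V δ a x t with hOdef
  have hOpos : (0 : ℝ) < O := by exact_mod_cast Nat.pos_of_ne_zero hO
  set F := (Finset.range t).filter fun s => x ∈ orbitNeighborhood G V (2 * δ) (a s) with hF
  have hFc : F.card = O := by
    rw [hOdef, obsCount, hF]
  have hnoise : noiseSum P G V δ a r x t = ∑ s ∈ F, (r s - meanReward P (a s)) := by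
    rw [noiseSum, hF, Finset.sum_filter]
    rfl
  have hemp : empiricalMean G V δ a r x t = (∑ s ∈ F, r s) / O := by
    rw [empiricalMean, hF]
  have hclose : ∀ s ∈ F, |meanReward P (a s) - meanReward P x| ≤ 2 * δ := by
    intro s hs
    obtain ⟨hst, -, g, hg, hgx⟩ := Finset.mem_filter.1 hs
    have has := hV _ (ha s (Finset.mem_range.1 hst))
    have himg : g '' X = X := hG hg
    rw [← hP.invariant g hg _ has]
    exact (hP.lipschitz _ (himg ▸ Set.mem_image_of_mem g has) x (hV x hx)).trans hgx
  have hdrift : |∑ s ∈ F, (meanReward P (a s) - meanReward P x)| ≤ O * (2 * δ) := by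
    refine (Finset.abs_sum_le_sum_abs _ _).trans ((Finset.sum_le_card_nsmul _ _ _ hclose).trans ?_)
    rw [nsmul_eq_mul, hFc]
  have hdecomp : empiricalMean G V δ a r x t - meanReward P x =
      (∑ s ∈ F, (meanReward P (a s) - meanReward P x) + noiseSum P G V δ a r x t) / O := by
    rw [hemp, hnoise, ← Finset.sum_add_distrib, eq_div_iff hOpos.ne', sub_mul,
      div_mul_cancel₀ _ hOpos.ne', ← hFc, mul_comm, ← nsmul_eq_mul, ← Finset.sum_const,
      ← Finset.sum_sub_distrib]
    exact Finset.sum_congr rfl fun s _ => by ring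
  have hsqrt : Real.sqrt (L * O) = O * Real.sqrt (L / O) := by
    have h : L * O = (O : ℝ) ^ 2 * (L / O) := by field_simp
    rw [h, Real.sqrt_mul (by positivity), Real.sqrt_sq hOpos.le]
  rw [hdecomp, abs_div, abs_of_pos hOpos, div_le_iff₀ hOpos]
  refine (abs_add_le _ _).trans ((add_le_add hdrift hgood).trans (le_of_eq ?_))
  rw [hsqrt]
  ring

theorem ucbIndex_of_ne_zero {d : ℕ} {n : ℕ} {G : Subgroup (E d ≃ᵢ E d)} {V : Finset (E d)} {δ : ℝ}
    {a : ℕ → E d} {r : ℕ → ℝ} {x : E d} {t : ℕ} (h : obsCount G V δ a x t ≠ 0) :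
    ucbIndex n G V δ a r x t = ((empiricalMean G V δ a r x t
      + Real.sqrt (2 * Real.log n / (obsCount G V δ a x t : ℝ)) + 3 * δ : ℝ) : EReal) := by
  simp [ucbIndex, h]

theorem ucbIndex_of_eq_zero {d : ℕ} {n : ℕ} {G : Subgroup (E d ≃ᵢ E d)} {V : Finset (E d)} {δ : ℝ}
    {a : ℕ → E d} {r : ℕ → ℝ} {x : E d} {t : ℕ} (h : obsCount G V δ a x t = 0) :
    ucbIndex n G V δ a r x t = ⊤ := by
  simp [ucbIndex, h]

/-- The bonus `3 * δ` pays for the bias `2 * δ` and the net error `δ`, so the index of a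
near-optimal mesh point is at least the supremum. The index of the played arm exceeds its mean by at
most `2 * δ + 3 * δ` and two confidence radii. -/
theorem gap_le_of_observed {d : ℕ} {X : Set (E d)} (hX : X.Nonempty) {G : Subgroup (E d ≃ᵢ E d)}
    (hG : G ≤ symmetryGroup X) {P : E d → MeasureTheory.Measure ℝ}
    (hP : IsInvariantLipschitzBandit X G P) {V : Finset (E d)} {δ : ℝ} (hV : IsNet X δ V)
    {n : ℕ} {a : ℕ → E d} {r : ℕ → ℝ} {t : ℕ} (ha : ∀ s ≤ t, a s ∈ V)
    (hmax : ∀ x ∈ V, ucbIndex n G V δ a r x t ≤ ucbIndex n G V δ a r (a t) t)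
    (hgood : ∀ x ∈ V,
      |noiseSum P G V δ a r x t| ≤ Real.sqrt (2 * Real.log n * obsCount G V δ a x t))
    (hO : obsCount G V δ a (a t) t ≠ 0) :
    sSup (meanReward P '' X) - meanReward P (a t) ≤
      5 * δ + 2 * Real.sqrt (2 * Real.log n / obsCount G V δ a (a t) t) := by
  obtain ⟨x, hx, hsup⟩ := exists_net_near_sup hP hX hV
  have h := hmax x hx
  have ha' : ∀ s < t, a s ∈ V := fun s hs => ha s hs.le
  rw [ucbIndex_of_ne_zero hO] at h
  -- An unobserved `x` would have index `⊤` and beat the finite index of the played arm.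
  by_cases hOx : obsCount G V δ a x t = 0
  · rw [ucbIndex_of_eq_zero hOx] at h
    exact absurd h (not_le.2 (EReal.coe_lt_top _))
  rw [ucbIndex_of_ne_zero hOx, EReal.coe_le_coe_iff] at h
  have h1 := abs_le.1 (abs_empiricalMean_sub_le hG hP hV.subset hx ha' hOx (hgood x hx))
  have h2 := abs_le.1 (abs_empiricalMean_sub_le hG hP hV.subset (ha t le_rfl) ha' hO
    (hgood _ (ha t le_rfl)))
  linarith [h1.1, h2.2]

/-- Within a class played `T` times, the numbers of earlier plays at its rounds are `0, …, T - 1`.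
-/
theorem sum_prior_count {α : Type*} [DecidableEq α] (h : ℕ → ℝ) (k : ℕ → α) (W : Finset α) (n : ℕ)
    (hk : ∀ t < n, k t ∈ W) :
    ∑ t ∈ Finset.range n, h ((Finset.range t).filter fun s => k s = k t).card =
      ∑ w ∈ W, ∑ m ∈ Finset.range ((Finset.range n).filter fun s => k s = w).card, h m := by
  induction n with
  | zero => simp
  | succ n ih =>
    rw [Finset.sum_range_succ, ih fun t ht => hk t (by omega)]
    have hw : ∀ w, ∑ m ∈ Finset.range ((Finset.range (n + 1)).filter fun s => k s = w).card, h m =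
        ∑ m ∈ Finset.range ((Finset.range n).filter fun s => k s = w).card, h m +
          if w = k n then h ((Finset.range n).filter fun s => k s = k n).card else 0 := by
      intro w
      rw [Finset.range_add_one, Finset.filter_insert]
      by_cases hkw : k n = w
      · subst hkw
        rw [if_pos rfl, if_pos rfl, Finset.card_insert_of_notMem (by simp), Finset.sum_range_succ]
      · rw [if_neg hkw, if_neg (Ne.symm hkw), add_zero]
    simp_rw [hw]
    rw [Finset.sum_add_distrib, Finset.sum_ite_eq' W (k n), if_pos (hk n n.lt_succ_self)]

theorem sum_exploration_le {b : ℝ} (hb : 0 ≤ b) (T : ℕ) :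
    ∑ m ∈ Finset.range T, (if m = 0 then 1 else 2 * (b / Real.sqrt m)) ≤
      1 + 4 * b * Real.sqrt T := by
  have key : ∀ T : ℕ, ∑ m ∈ Finset.range (T + 1), (if m = 0 then 1 else 2 * (b / Real.sqrt m)) ≤
      1 + 4 * b * Real.sqrt T := by
    intro T
    induction T with
    | zero => simp
    | succ T ih =>
      rw [Finset.sum_range_succ, if_neg T.succ_ne_zero]
      push_cast
      set x := Real.sqrt T
      set y := Real.sqrt ((T : ℝ) + 1)
      have hx : x ^ 2 = T := Real.sq_sqrt (Nat.cast_nonneg T)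
      have hy : y ^ 2 = T + 1 := Real.sq_sqrt (by positivity)
      have hy0 : 0 < y := Real.sqrt_pos.2 (by positivity)
      -- Telescoping bound `1/√(T+1) ≤ 2(√(T+1) - √T)`.
      have h1 : 1 / y ≤ 2 * (y - x) := by
        rw [div_le_iff₀ hy0]
        nlinarith [sq_nonneg (x - y)]
      have h2 : b / y ≤ b * (2 * (y - x)) := by
        rw [div_eq_mul_one_div]
        exact mul_le_mul_of_nonneg_left h1 hb
      linarith
  rcases T with _ | T
  · simp
  · refine (key T).trans ?_
    gcongr
    exact T.le_succ

theorem sum_sqrt_le {α : Type*} (W : Finset α) (T : α → ℕ) :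
    ∑ w ∈ W, Real.sqrt (T w) ≤ Real.sqrt (W.card * ∑ w ∈ W, T w) := by
  refine Real.le_sqrt_of_sq_le (sq_sum_le_card_mul_sum_sq.trans (le_of_eq ?_))
  congr 1
  push_cast
  exact Finset.sum_congr rfl fun w _ => Real.sq_sqrt (Nat.cast_nonneg _)

theorem sum_gap_le {d : ℕ} {X : Set (E d)} (hX : X.Nonempty) {G : Subgroup (E d ≃ᵢ E d)}
    (hG : G ≤ symmetryGroup X) {P : E d → MeasureTheory.Measure ℝ}
    (hP : IsInvariantLipschitzBandit X G P) {V : Finset (E d)} {δ : ℝ} (hδ : 0 < δ)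
    (hV : IsNet X δ V) {W : Finset (E d)} {κ : E d → E d} (hκW : ∀ v ∈ V, κ v ∈ W)
    (hκ : ∀ v ∈ V, ∀ v' ∈ V, κ v = κ v' → ∃ g ∈ G, dist (g v) v' ≤ 2 * δ)
    {n : ℕ} {a : ℕ → E d} {r : ℕ → ℝ} (ha : ∀ t < n, a t ∈ V)
    (hmax : ∀ t < n, ∀ x ∈ V, ucbIndex n G V δ a r x t ≤ ucbIndex n G V δ a r (a t) t)
    (hgood : ∀ x ∈ V, ∀ t < n,
      |noiseSum P G V δ a r x t| ≤ Real.sqrt (2 * Real.log n * obsCount G V δ a x t)) :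
    ∑ t ∈ Finset.range n, (sSup (meanReward P '' X) - meanReward P (a t)) ≤
      5 * δ * n + W.card + 4 * Real.sqrt (2 * Real.log n) * Real.sqrt (W.card * n) := by
  classical
  set b := Real.sqrt (2 * Real.log n) with hb
  have hb0 : 0 ≤ b := Real.sqrt_nonneg _
  let h : ℕ → ℝ := fun m => if m = 0 then 1 else 2 * (b / Real.sqrt m)
  have hterm : ∀ t ∈ Finset.range n, sSup (meanReward P '' X) - meanReward P (a t) ≤
      5 * δ + h ((Finset.range t).filter fun s => κ (a s) = κ (a t)).card := by
    intro t ht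
    rw [Finset.mem_range] at ht
    set m := ((Finset.range t).filter fun s => κ (a s) = κ (a t)).card with hm
    -- Each earlier play in the class of `a t` came within `2 * δ` of `a t` up to `G`, hence
    -- observed it.
    have hmO : m ≤ obsCount G V δ a (a t) t := by
      rw [hm, obsCount]
      refine Finset.card_le_card fun s hs => ?_
      rw [Finset.mem_filter] at hs ⊢
      have hst := Finset.mem_range.1 hs.1
      exact ⟨hs.1, ha t ht, hκ _ (ha s (hst.trans ht)) _ (ha t ht) hs.2⟩
    by_cases hm0 : m = 0
    · have := (gap_mem_Icc hP (hV.subset _ (ha t ht))).2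
      simp only [h, hm0, if_true]
      linarith
    · have hmpos : (0 : ℝ) < m := by exact_mod_cast Nat.pos_of_ne_zero hm0
      have h1 := gap_le_of_observed hX hG hP hV (fun s hs => ha s (hs.trans_lt ht)) (hmax t ht)
        (fun x hx => hgood x hx t ht) (show obsCount G V δ a (a t) t ≠ 0 by omega)
      refine h1.trans ?_
      simp only [h, hm0, if_false]
      rw [hb, ← Real.sqrt_div' _ hmpos.le]
      have hlog := Real.log_natCast_nonneg n
      have : (m : ℝ) ≤ obsCount G V δ a (a t) t := by exact_mod_cast hmO
      gcongr
  have hTsum : ∑ w ∈ W, ((Finset.range n).filter fun s => κ (a s) = w).card = n := by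
    rw [← Finset.card_eq_sum_card_fiberwise, Finset.card_range]
    exact fun t ht => hκW _ (ha t (Finset.mem_range.1 (Finset.mem_coe.1 ht)))
  refine (Finset.sum_le_sum hterm).trans ?_
  rw [Finset.sum_add_distrib, sum_prior_count h (fun s => κ (a s)) W n
    fun t ht => hκW _ (ha t ht)]
  have h2 : ∑ w ∈ W, ∑ m ∈ Finset.range ((Finset.range n).filter fun s => κ (a s) = w).card, h m ≤
      ∑ w ∈ W, (1 + 4 * b * Real.sqrt ((Finset.range n).filter fun s => κ (a s) = w).card) :=
    Finset.sum_le_sum fun w _ => sum_exploration_le hb0 _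
  rw [Finset.sum_add_distrib, ← Finset.mul_sum] at h2
  have h3 := sum_sqrt_le W fun w => ((Finset.range n).filter fun s => κ (a s) = w).card
  rw [hTsum] at h3
  simp only [Finset.sum_const, nsmul_eq_mul, Finset.card_range, mul_one] at h2 ⊢
  have h4 := mul_le_mul_of_nonneg_left h3 (show 0 ≤ 4 * b by positivity)
  linarith

/-! ### Concentration of the reward averages -/

/-- No measurability of `v ↦ P v` is assumed; finiteness of the mesh replaces it. -/
theorem measurable_comp_of_mem_finset {Ω α β : Type*} [MeasurableSpace Ω] [MeasurableSpace α]
    [MeasurableSingletonClass α] [MeasurableSpace β] {A : Ω → α} (hA : Measurable A)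
    {V : Finset α} (hV : ∀ ω, A ω ∈ V) (F : α → β) : Measurable fun ω => F (A ω) := by
  intro S _
  have : (fun ω => F (A ω)) ⁻¹' S = A ⁻¹' (F ⁻¹' S ∩ V) := by
    ext ω
    simp [hV ω]
  rw [this]
  exact hA (V.finite_toSet.inter_of_right _).measurableSet

/-- If, given `H`, the law of `Y` is `P (A ω)`, then on `{A = v}` the variable `Y` has the law `P v`
and is independent of `H`. -/
theorem setLIntegral_mul_comp_eq {Ω α : Type*} {H m0 : MeasurableSpace Ω} [MeasurableSpace α]
    [MeasurableSingletonClass α] {μ : MeasureTheory.Measure Ω} [MeasureTheory.IsFiniteMeasure μ]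
    (hH : H ≤ m0) {A : Ω → α} (hA : Measurable[H] A) {Y : Ω → ℝ} (hY : Measurable Y)
    {P : α → MeasureTheory.Measure ℝ}
    (hlaw : ∀ B : Set ℝ, MeasurableSet B →
      μ[(Y ⁻¹' B).indicator (fun _ => (1 : ℝ)) | H] =ᵐ[μ] fun ω => (P (A ω)).real B)
    (v : α) [MeasureTheory.IsFiniteMeasure (P v)] {Z : Ω → ENNReal} (hZ : Measurable[H] Z)
    {φ : ℝ → ENNReal} (hφ : Measurable φ) :
    ∫⁻ ω in A ⁻¹' {v}, Z ω * φ (Y ω) ∂μ =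
      (∫⁻ ω in A ⁻¹' {v}, Z ω ∂μ) * ∫⁻ y, φ y ∂(P v) := by
  have hAv : MeasurableSet[H] (A ⁻¹' {v}) := hA (measurableSet_singleton v)
  have hset : ∀ S, MeasurableSet[H] S → ∀ B : Set ℝ, MeasurableSet B →
      μ (S ∩ Y ⁻¹' B ∩ A ⁻¹' {v}) = P v B * μ (S ∩ A ⁻¹' {v}) := by
    intro S hS B hB
    have hS' : MeasurableSet[H] (S ∩ A ⁻¹' {v}) := hS.inter hAv
    have hint : MeasureTheory.Integrable ((Y ⁻¹' B).indicator (fun _ => (1 : ℝ))) μ :=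
      (MeasureTheory.integrable_const _).indicator (hY hB)
    have h1 := MeasureTheory.setIntegral_condExp hH hint hS'
    have h2 : ∫ ω in S ∩ A ⁻¹' {v}, (μ[(Y ⁻¹' B).indicator (fun _ => (1 : ℝ)) | H]) ω ∂μ =
        ∫ ω in S ∩ A ⁻¹' {v}, (P v).real B ∂μ := by
      refine MeasureTheory.setIntegral_congr_ae (hH _ hS') ?_
      filter_upwards [hlaw B hB] with ω hω hmem
      have : A ω = v := hmem.2
      rw [hω, this]
    rw [h2, MeasureTheory.integral_indicator (hY hB), MeasureTheory.setIntegral_const,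
      MeasureTheory.setIntegral_const, smul_eq_mul, smul_eq_mul, mul_one,
      MeasureTheory.measureReal_restrict_apply' (hH _ hS')] at h1
    rw [← ENNReal.toReal_eq_toReal_iff' (by finiteness) (by finiteness), ENNReal.toReal_mul]
    have h3 : S ∩ Y ⁻¹' B ∩ A ⁻¹' {v} = Y ⁻¹' B ∩ (S ∩ A ⁻¹' {v}) := by
      ext; simp only [Set.mem_inter_iff]; tauto
    rw [h3]
    simp only [MeasureTheory.Measure.real] at h1
    linarith
  have hmap : ((μ.restrict (A ⁻¹' {v})).withDensity Z).map Y =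
      (∫⁻ ω in A ⁻¹' {v}, Z ω ∂μ) • P v := by
    ext B hB
    rw [MeasureTheory.Measure.map_apply hY hB, MeasureTheory.withDensity_apply _ (hY hB),
      MeasureTheory.Measure.smul_apply, smul_eq_mul]
    -- The product formula `hset` is known only for `S` in `H`, so the measures are compared on `H`;
    -- this suffices because `Z` is `H`-measurable.
    have htrim : ((μ.restrict (A ⁻¹' {v})).restrict (Y ⁻¹' B)).trim hH =
        P v B • (μ.restrict (A ⁻¹' {v})).trim hH := by
      refine @MeasureTheory.Measure.ext _ H _ _ fun S hS => ?_
      rw [MeasureTheory.Measure.smul_apply, MeasureTheory.trim_measurableSet_eq hH hS,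
        MeasureTheory.trim_measurableSet_eq hH hS,
        MeasureTheory.Measure.restrict_apply (hH _ hS),
        MeasureTheory.Measure.restrict_apply (hH _ hS),
        MeasureTheory.Measure.restrict_apply ((hH _ hS).inter (hY hB)), smul_eq_mul,
        hset S hS B hB]
    rw [← MeasureTheory.lintegral_trim hH hZ, htrim, MeasureTheory.lintegral_smul_measure,
      MeasureTheory.lintegral_trim hH hZ, smul_eq_mul, mul_comm]
  have hZ' : Measurable Z := hZ.mono hH le_rfl
  calc _ = ∫⁻ ω, φ (Y ω) ∂((μ.restrict (A ⁻¹' {v})).withDensity Z) :=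
        (MeasureTheory.lintegral_withDensity_eq_lintegral_mul _ hZ' (hφ.comp hY)).symm
    _ = ∫⁻ y, φ y ∂(((μ.restrict (A ⁻¹' {v})).withDensity Z).map Y) :=
        (MeasureTheory.lintegral_map hφ hY).symm
    _ = _ := by rw [hmap, MeasureTheory.lintegral_smul_measure, smul_eq_mul]

theorem lintegral_eq_sum_fibers {Ω α : Type*} [MeasurableSpace Ω] [MeasurableSpace α]
    [MeasurableSingletonClass α] {μ : MeasureTheory.Measure Ω} {A : Ω → α} (hA : Measurable A)
    {V : Finset α} (hV : ∀ ω, A ω ∈ V) (F : Ω → ENNReal) :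
    ∫⁻ ω, F ω ∂μ = ∑ v ∈ V, ∫⁻ ω in A ⁻¹' {v}, F ω ∂μ := by
  rw [← MeasureTheory.lintegral_biUnion_finset]
  · have : ⋃ v ∈ V, A ⁻¹' {v} = Set.univ := by
      ext ω
      simp [hV ω]
    rw [this, MeasureTheory.Measure.restrict_univ]
  · intro v _ w _ hvw
    exact Disjoint.preimage _ (Set.disjoint_singleton.2 hvw)
  · exact fun v _ => hA (measurableSet_singleton v)

theorem measurable_arm_history {d : ℕ} {Ω : Type*} (A : ℕ → Ω → E d) (Y : ℕ → Ω → ℝ) {s t : ℕ}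
    (h : s ≤ t) : Measurable[history A Y t] (A s) := by
  rw [measurable_iff_comap_le]
  refine le_trans ?_ le_sup_left
  exact le_iSup₂_of_le s (Finset.mem_range.2 (by omega)) le_rfl

theorem measurable_reward_history {d : ℕ} {Ω : Type*} (A : ℕ → Ω → E d) (Y : ℕ → Ω → ℝ) {s t : ℕ}
    (h : s < t) : Measurable[history A Y t] (Y s) := by
  rw [measurable_iff_comap_le]
  refine le_trans ?_ le_sup_right
  exact le_iSup₂_of_le s (Finset.mem_range.2 h) le_rfl

/-- Hoeffding's lemma: a variable in `[0, 1]` is sub-Gaussian with variance proxy `1/4`. -/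
theorem lintegral_exp_centered_le_one {ν : MeasureTheory.Measure ℝ}
    [MeasureTheory.IsProbabilityMeasure ν] (hν : ∀ᵐ y ∂ν, y ∈ Set.Icc (0 : ℝ) 1) (l : ℝ) :
    ∫⁻ y, ENNReal.ofReal (Real.exp (l * y + (-(l * ∫ z, z ∂ν) - l ^ 2 / 8))) ∂ν ≤ 1 := by
  have h := ProbabilityTheory.hasSubgaussianMGF_of_mem_Icc (μ := ν) (X := fun y => y)
    aemeasurable_id hν
  have h1 := h.mgf_le l
  have h2 := h.integrable_exp_mul l
  have h3 : ∀ y : ℝ, Real.exp (l * y + (-(l * ∫ z, z ∂ν) - l ^ 2 / 8)) =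
      Real.exp (l * (y - ∫ z, z ∂ν)) * Real.exp (-(l ^ 2 / 8)) := by
    intro y
    rw [← Real.exp_add]
    ring_nf
  simp_rw [h3]
  rw [← MeasureTheory.ofReal_integral_eq_lintegral_ofReal (h2.mul_const _)
    (Filter.Eventually.of_forall fun _ => by positivity), MeasureTheory.integral_mul_const,
    ENNReal.ofReal_le_one]
  have h4 : Real.exp (((‖(1 : ℝ) - 0‖₊ / 2) ^ 2 : NNReal) * l ^ 2 / 2) = Real.exp (l ^ 2 / 8) := by
    congr 1
    push_cast
    simp
    ring
  rw [h4] at h1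
  calc _ ≤ Real.exp (l ^ 2 / 8) * Real.exp (-(l ^ 2 / 8)) := by gcongr; exact h1
    _ = 1 := by rw [← Real.exp_add, add_neg_cancel, Real.exp_zero]

section

variable {d : ℕ} {Ω : Type*} [MeasurableSpace Ω] {μ : MeasureTheory.Measure Ω}
  {P : E d → MeasureTheory.Measure ℝ} {n : ℕ}
  {V : Finset (E d)} {δ : ℝ} {G : Subgroup (E d ≃ᵢ E d)} {A : ℕ → Ω → E d} {Y : ℕ → Ω → ℝ}

theorem IsUniformMeshN.history_le (hA : IsUniformMeshN μ P n V δ G A Y) {t : ℕ} (ht : t < n) :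
    history A Y t ≤ ‹MeasurableSpace Ω› := by
  refine sup_le (iSup₂_le fun s hs => ?_) (iSup₂_le fun s hs => ?_)
  · exact (hA.measurable_arm s (by rw [Finset.mem_range] at hs; omega)).comap_le
  · exact (hA.measurable_reward s (by rw [Finset.mem_range] at hs; omega)).comap_le

/-- Exponential supermartingale bound, for increments that are affine in the reward. -/
theorem IsUniformMeshN.lintegral_exp_le_one [MeasureTheory.IsProbabilityMeasure μ]
    (hA : IsUniformMeshN μ P n V δ G A Y)
    (hprob : ∀ v ∈ V, MeasureTheory.IsProbabilityMeasure (P v)) (c₁ c₂ : E d → ℝ)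
    (hc : ∀ v ∈ V, ∫⁻ y, ENNReal.ofReal (Real.exp (c₁ v * y + c₂ v)) ∂(P v) ≤ 1) {t : ℕ}
    (ht : t ≤ n) :
    ∫⁻ ω, ENNReal.ofReal (Real.exp (∑ s ∈ Finset.range t,
      (c₁ (A s ω) * Y s ω + c₂ (A s ω)))) ∂μ ≤ 1 := by
  induction t with
  | zero => simp
  | succ t ih =>
    refine le_trans ?_ (ih (by omega))
    have ht' : t < n := ht
    have hH := hA.history_le ht'
    set Z : Ω → ENNReal := fun ω => ENNReal.ofReal (Real.exp (∑ s ∈ Finset.range t,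
      (c₁ (A s ω) * Y s ω + c₂ (A s ω)))) with hZdef
    have hZ : Measurable[history A Y t] Z := by
      refine ENNReal.measurable_ofReal.comp (Real.measurable_exp.comp
        (Finset.measurable_fun_sum _ fun s hs => ?_))
      have hs' := Finset.mem_range.1 hs
      have hV : ∀ ω, A s ω ∈ V := hA.arm_mem s (hs'.trans ht')
      have hAs := measurable_arm_history A Y hs'.le
      exact ((@measurable_comp_of_mem_finset _ _ _ (history A Y t) _ _ _ _ hAs _ hV c₁).mul
        (measurable_reward_history A Y hs')).add
        (@measurable_comp_of_mem_finset _ _ _ (history A Y t) _ _ _ _ hAs _ hV c₂)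
    have hAt := hA.measurable_arm t ht'
    have hVt := hA.arm_mem t ht'
    rw [lintegral_eq_sum_fibers hAt hVt, lintegral_eq_sum_fibers hAt hVt]
    refine Finset.sum_le_sum fun v hv => ?_
    have := hprob v hv
    calc _ = ∫⁻ ω in A t ⁻¹' {v}, Z ω *
          (fun y => ENNReal.ofReal (Real.exp (c₁ v * y + c₂ v))) (Y t ω) ∂μ := by
          refine MeasureTheory.setLIntegral_congr_fun (hAt (measurableSet_singleton v))
            fun ω hω => ?_
          have hω' : A t ω = v := hω
          simp only [hZdef]
          rw [Finset.sum_range_succ, Real.exp_add, ENNReal.ofReal_mul (Real.exp_nonneg _), hω']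
      _ = (∫⁻ ω in A t ⁻¹' {v}, Z ω ∂μ) *
          ∫⁻ y, ENNReal.ofReal (Real.exp (c₁ v * y + c₂ v)) ∂(P v) :=
          setLIntegral_mul_comp_eq hH (measurable_arm_history A Y le_rfl)
            (hA.measurable_reward t ht') (hA.reward_law t ht') v hZ
            (φ := fun y => ENNReal.ofReal (Real.exp (c₁ v * y + c₂ v))) (by fun_prop)
      _ ≤ _ := mul_le_of_le_one_right' (hc v hv)

theorem mul_noiseSum_sub_eq (l : ℝ) (a : ℕ → E d) (r : ℕ → ℝ) (x : E d) (t : ℕ) :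
    l * noiseSum P G V δ a r x t - l ^ 2 / 8 * obsCount G V δ a x t =
      ∑ s ∈ Finset.range t, ({v | x ∈ orbitNeighborhood G V (2 * δ) v}.indicator (fun _ => l) (a s) *
        r s + {v | x ∈ orbitNeighborhood G V (2 * δ) v}.indicator
          (fun v => -(l * meanReward P v) - l ^ 2 / 8) (a s)) := by
  classical
  rw [noiseSum, obsCount, Finset.card_filter, Nat.cast_sum, Finset.mul_sum, Finset.mul_sum,
    ← Finset.sum_sub_distrib]
  refine Finset.sum_congr rfl fun s _ => ?_
  by_cases h : x ∈ orbitNeighborhood G V (2 * δ) (a s)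
  · simp [h]
    ring
  · simp [h]

/-- Markov's inequality for the exponential supermartingale. The count is random, so it stays in the
compensator and `l` is deterministic. -/
theorem IsUniformMeshN.measure_noise_le [MeasureTheory.IsProbabilityMeasure μ]
    {X : Set (E d)} (hP : IsInvariantLipschitzBandit X G P) (hV : ∀ v ∈ V, v ∈ X)
    (hA : IsUniformMeshN μ P n V δ G A Y) (x : E d) {t : ℕ} (ht : t ≤ n) (l b : ℝ) :
    μ {ω | b ≤ l * noiseSum P G V δ (fun s => A s ω) (fun s => Y s ω) x t -
      l ^ 2 / 8 * obsCount G V δ (fun s => A s ω) x t} ≤ ENNReal.ofReal (Real.exp (-b)) := by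
  set c₁ : E d → ℝ := {v | x ∈ orbitNeighborhood G V (2 * δ) v}.indicator (fun _ => l) with hc₁
  set c₂ : E d → ℝ := {v | x ∈ orbitNeighborhood G V (2 * δ) v}.indicator
    (fun v => -(l * meanReward P v) - l ^ 2 / 8) with hc₂
  have hprob : ∀ v ∈ V, MeasureTheory.IsProbabilityMeasure (P v) := fun v hv => hP.prob v (hV v hv)
  have hint := hA.lintegral_exp_le_one hprob c₁ c₂ (fun v hv => by
    have := hprob v hv
    by_cases h : x ∈ orbitNeighborhood G V (2 * δ) v
    · simp only [hc₁, hc₂]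
      rw [Set.indicator_of_mem (by exact h), Set.indicator_of_mem (by exact h)]
      exact lintegral_exp_centered_le_one (hP.support v (hV v hv)) l
    · simp only [hc₁, hc₂]
      rw [Set.indicator_of_notMem (by exact h), Set.indicator_of_notMem (by exact h)]
      simp) ht
  simp_rw [mul_noiseSum_sub_eq]
  have hmeas : Measurable fun ω => ENNReal.ofReal (Real.exp (∑ s ∈ Finset.range t,
      (c₁ (A s ω) * Y s ω + c₂ (A s ω)))) := by
    refine ENNReal.measurable_ofReal.comp (Real.measurable_exp.comp
      (Finset.measurable_fun_sum _ fun s hs => ?_))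
    have hs' := (Finset.mem_range.1 hs).trans_le ht
    have hAs := hA.measurable_arm s hs'
    have hVs := hA.arm_mem s hs'
    exact ((measurable_comp_of_mem_finset hAs hVs c₁).mul (hA.measurable_reward s hs')).add
      (measurable_comp_of_mem_finset hAs hVs c₂)
  have hmarkov := (MeasureTheory.mul_meas_ge_le_lintegral hmeas
    (ENNReal.ofReal (Real.exp b))).trans hint
  rw [Real.exp_neg, ENNReal.ofReal_inv_of_pos (Real.exp_pos b), ENNReal.le_inv_iff_mul_le,
    mul_comm]
  refine le_trans ?_ hmarkov
  exact mul_le_mul' le_rfl (MeasureTheory.measure_mono fun ω hω =>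
    ENNReal.ofReal_le_ofReal (Real.exp_le_exp.2 hω))

/-- The reward averages concentrate, uniformly over the mesh and the rounds. -/
theorem IsUniformMeshN.measure_bad_le [MeasureTheory.IsProbabilityMeasure μ]
    {X : Set (E d)} (hP : IsInvariantLipschitzBandit X G P) (hV : ∀ v ∈ V, v ∈ X)
    (hA : IsUniformMeshN μ P n V δ G A Y) (hn : 2 ≤ n) :
    (n : ℝ) * μ.real {ω | ∃ x ∈ V, ∃ t < n,
      Real.sqrt (2 * Real.log n * obsCount G V δ (fun s => A s ω) x t) <
        |noiseSum P G V δ (fun s => A s ω) (fun s => Y s ω) x t|} ≤ V.card := by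
  classical
  have hn0 : (0 : ℝ) < n := by positivity
  have hL : 0 < Real.log n := Real.log_pos (by exact_mod_cast hn)
  set L := Real.log n with hLdef
  -- The maximizer of `λ * s - λ ^ 2 * m / 8` at `s = √(2 * L * m)`, with value `4 * L`. As the
  -- count is random, the union bound also runs over its values `m < n` and the sign, giving `2 * n
  -- ^ 2 * |V|` events of probability at most `n ^ (-4)`.
  let l : ℕ → ℝ := fun m => 4 * Real.sqrt (2 * L * m) / m
  let S : E d → ℕ → Ω → ℝ := fun x t ω => noiseSum P G V δ (fun s => A s ω) (fun s => Y s ω) x t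
  let O : E d → ℕ → Ω → ℕ := fun x t ω => obsCount G V δ (fun s => A s ω) x t
  let B : E d → ℕ → ℕ → Bool → Set Ω := fun x t m e =>
    {ω | 4 * L ≤ (if e then l m else -l m) * S x t ω - (if e then l m else -l m) ^ 2 / 8 * O x t ω}
  have hB : ∀ x t m e, t < n → μ.real (B x t m e) ≤ 1 / (n : ℝ) ^ 4 := by
    intro x t m e ht
    have h := hA.measure_noise_le hP hV x ht.le (if e then l m else -l m) (4 * L)
    have h2 : Real.exp (-(4 * L)) = 1 / (n : ℝ) ^ 4 := by
      have : Real.exp (4 * L) = (n : ℝ) ^ 4 := by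
        rw [show 4 * L = ((4 : ℕ) : ℝ) * L by norm_num, Real.exp_nat_mul, hLdef, Real.exp_log hn0]
      rw [Real.exp_neg, this, one_div]
    rw [h2] at h
    exact ENNReal.toReal_le_of_le_ofReal (by positivity) h
  have hsub : {ω | ∃ x ∈ V, ∃ t < n, Real.sqrt (2 * L * O x t ω) < |S x t ω|} ⊆
      ⋃ q ∈ V ×ˢ Finset.range n ×ˢ Finset.range n ×ˢ (Finset.univ : Finset Bool),
        B q.1 q.2.1 q.2.2.1 q.2.2.2 := by
    rintro ω ⟨x, hx, t, ht, hω⟩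
    have hOt : O x t ω ≤ t := (Finset.card_filter_le _ _).trans (by simp)
    have hO0 : O x t ω ≠ 0 := by
      intro h0
      have : S x t ω = 0 := by
        refine Finset.sum_eq_zero fun s hs => Set.indicator_of_notMem (fun hmem => ?_) _
        exact Finset.card_ne_zero_of_mem (Finset.mem_filter.2 ⟨hs, hmem⟩) h0
      rw [this, h0] at hω
      simp at hω
    have hOpos : (0 : ℝ) < O x t ω := by exact_mod_cast Nat.pos_of_ne_zero hO0
    set m := O x t ω with hm
    have hsq : Real.sqrt (2 * L * m) ^ 2 = 2 * L * m := Real.sq_sqrt (by positivity)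
    have hl0 : 0 ≤ l m := by positivity
    have hl1 : l m * Real.sqrt (2 * L * m) = 8 * L := by
      simp only [l]
      rw [div_mul_eq_mul_div, div_eq_iff hOpos.ne']
      linarith
    have hl2 : l m ^ 2 / 8 * m = 4 * L := by
      simp only [l]
      rw [div_pow, mul_pow, hsq]
      field_simp
      ring
    have hkey : 4 * L ≤ l m * |S x t ω| - l m ^ 2 / 8 * m := by
      have := mul_le_mul_of_nonneg_left hω.le hl0
      linarith
    refine Set.mem_iUnion₂.2 ⟨(x, t, m, decide (0 ≤ S x t ω)), ?_, ?_⟩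
    · simp only [Finset.mem_product, Finset.mem_range, Finset.mem_univ, and_true]
      exact ⟨hx, ht, by omega⟩
    · change 4 * L ≤ (if decide (0 ≤ S x t ω) then l m else -l m) * S x t ω -
        (if decide (0 ≤ S x t ω) then l m else -l m) ^ 2 / 8 * m
      by_cases h : 0 ≤ S x t ω
      · simpa [h, abs_of_nonneg h] using hkey
      · simpa [h, abs_of_neg (not_le.1 h)] using hkey
  have h1 : μ.real {ω | ∃ x ∈ V, ∃ t < n, Real.sqrt (2 * L * O x t ω) < |S x t ω|} ≤
      V.card * (n * (n * 2)) * (1 / (n : ℝ) ^ 4) := by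
    refine (MeasureTheory.measureReal_mono hsub (MeasureTheory.measure_ne_top _ _)).trans
      ((MeasureTheory.measureReal_biUnion_finset_le _ _).trans
      ((Finset.sum_le_card_nsmul _ _ (1 / (n : ℝ) ^ 4) fun q hq => ?_).trans (le_of_eq ?_)))
    · simp only [Finset.mem_product, Finset.mem_range] at hq
      exact hB _ _ _ _ hq.2.1
    · simp [Finset.card_product, nsmul_eq_mul]
  calc _ ≤ n * (V.card * (n * (n * 2)) * (1 / (n : ℝ) ^ 4)) := by gcongr
    _ = V.card * (2 / n) := by field_simp
    _ ≤ V.card * 1 := by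
      gcongr
      rw [div_le_one hn0]
      exact_mod_cast hn
    _ = _ := mul_one _

end

/-! ### Expected regret in terms of the mesh and the classes -/

theorem IsUniformMeshN.regret_le {d : ℕ} {Ω : Type*} [MeasurableSpace Ω]
    {μ : MeasureTheory.Measure Ω} [MeasureTheory.IsProbabilityMeasure μ] {X : Set (E d)}
    (hX : X.Nonempty) {G : Subgroup (E d ≃ᵢ E d)} (hG : G ≤ symmetryGroup X)
    {P : E d → MeasureTheory.Measure ℝ} (hP : IsInvariantLipschitzBandit X G P)
    {n : ℕ} (hn : 2 ≤ n) {V : Finset (E d)} {δ : ℝ} (hδ : 0 < δ) (hV : IsNet X δ V)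
    {W : Finset (E d)} {κ : E d → E d} (hκW : ∀ v ∈ V, κ v ∈ W)
    (hκ : ∀ v ∈ V, ∀ v' ∈ V, κ v = κ v' → ∃ g ∈ G, dist (g v) v' ≤ 2 * δ)
    {A : ℕ → Ω → E d} {Y : ℕ → Ω → ℝ} (hA : IsUniformMeshN μ P n V δ G A Y) :
    regret μ X P n A ≤ 5 * δ * n + W.card +
      4 * Real.sqrt (2 * Real.log n) * Real.sqrt (W.card * n) + V.card := by
  set b := 5 * δ * n + W.card + 4 * Real.sqrt (2 * Real.log n) * Real.sqrt (W.card * n) with hb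
  have hb0 : 0 ≤ b := by positivity
  set bad : Set Ω := {ω | ∃ x ∈ V, ∃ t < n,
      Real.sqrt (2 * Real.log n * obsCount G V δ (fun s => A s ω) x t) <
        |noiseSum P G V δ (fun s => A s ω) (fun s => Y s ω) x t|} with hbad
  -- A measurable hull of the same measure avoids proving that `bad` is measurable.
  have hM : MeasurableSet (MeasureTheory.toMeasurable μ bad) :=
    MeasureTheory.measurableSet_toMeasurable μ bad
  have hgap : ∀ ω, ∀ t ∈ Finset.range n,
      sSup (meanReward P '' X) - meanReward P (A t ω) ∈ Set.Icc (0 : ℝ) 1 := fun ω t ht =>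
    gap_mem_Icc hP (hV.subset _ (hA.arm_mem t (Finset.mem_range.1 ht) ω))
  have hint : MeasureTheory.Integrable
      (fun ω => b + (MeasureTheory.toMeasurable μ bad).indicator (fun _ => (n : ℝ)) ω) μ :=
    (MeasureTheory.integrable_const b).add ((MeasureTheory.integrable_const (n : ℝ)).indicator hM)
  have hle : ∀ ω, ∑ t ∈ Finset.range n, (sSup (meanReward P '' X) - meanReward P (A t ω)) ≤
      b + (MeasureTheory.toMeasurable μ bad).indicator (fun _ => (n : ℝ)) ω := by
    intro ω
    by_cases hω : ω ∈ bad
    · rw [Set.indicator_of_mem (MeasureTheory.subset_toMeasurable μ bad hω)]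
      have := Finset.sum_le_card_nsmul _ _ 1 fun t ht => (hgap ω t ht).2
      rw [Finset.card_range, nsmul_eq_mul, mul_one] at this
      linarith
    · refine le_add_of_le_of_nonneg ?_ (Set.indicator_nonneg (fun _ _ => Nat.cast_nonneg n) _)
      simp only [hbad, Set.mem_ofPred_eq] at hω
      push Not at hω
      exact sum_gap_le hX hG hP hδ hV hκW hκ (r := fun s => Y s ω)
        (fun t ht => hA.arm_mem t ht ω) (fun t ht => hA.arm_max t ht ω) hω
  calc regret μ X P n A
      ≤ ∫ ω, (b + (MeasureTheory.toMeasurable μ bad).indicator (fun _ => (n : ℝ)) ω) ∂μ :=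
        MeasureTheory.integral_mono_of_nonneg
          (Filter.Eventually.of_forall fun ω => Finset.sum_nonneg fun t ht => (hgap ω t ht).1)
          hint (Filter.Eventually.of_forall hle)
    _ = b + n * μ.real bad := by
        rw [MeasureTheory.integral_add (MeasureTheory.integrable_const b)
          ((MeasureTheory.integrable_const (n : ℝ)).indicator hM),
          MeasureTheory.integral_indicator_const _ hM, MeasureTheory.integral_const]
        simp only [MeasureTheory.Measure.real, MeasureTheory.measure_toMeasurable,
          MeasureTheory.measure_univ, ENNReal.toReal_one, smul_eq_mul, one_mul]
        ring
    _ ≤ b + V.card := by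
        gcongr
        exact hA.measure_bad_le hP hV.subset hn

/-! ### Arithmetic of the mesh width and the final bound -/

/-- Here `(g * δ) ^ (d + 2) = g ^ (d + 1) * log n / n`. The hypothesis `hcg` says `g ^ (d + 1) ≤ √(n
/ c)`, and `log n ≤ 2 * √n` absorbs the rest. -/
theorem group_mul_width_le {n g δ c : ℝ} {d : ℕ} (hn : 1 ≤ n) (hg : 0 < g)
    (hc : 0 < c) (hcg : c * g ^ (2 * d + 2) ≤ n) (hδp : δ ^ (d + 2) = Real.log n / (n * g)) :
    g * δ ≤ 1 + 2 / Real.sqrt c := by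
  have hn0 : 0 < n := by linarith
  have hsn : 0 < Real.sqrt n := Real.sqrt_pos.2 hn0
  have hsc : 0 < Real.sqrt c := Real.sqrt_pos.2 hc
  have hsq : Real.sqrt n ^ 2 = n := Real.sq_sqrt hn0.le
  have hlog : Real.log n ≤ 2 * Real.sqrt n := by
    have h1 := Real.log_le_sub_one_of_pos hsn
    rw [Real.log_sqrt hn0.le] at h1
    linarith
  have hg1 : Real.sqrt c * g ^ (d + 1) ≤ Real.sqrt n := by
    refine Real.le_sqrt_of_sq_le ?_
    rw [mul_pow, Real.sq_sqrt hc.le, ← pow_mul]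
    convert hcg using 3
    ring
  have hpow : (g * δ) ^ (d + 2) ≤ 2 / Real.sqrt c := by
    have h1 : (g * δ) ^ (d + 2) = g ^ (d + 1) * Real.log n / n := by
      rw [mul_pow, hδp]
      field_simp
      ring
    rw [h1, div_le_div_iff₀ hn0 hsc]
    have h2 : Real.sqrt c * g ^ (d + 1) * Real.log n ≤ Real.sqrt n * (2 * Real.sqrt n) :=
      mul_le_mul hg1 hlog (Real.log_nonneg hn) hsn.le
    nlinarith
  have hpos : 0 < 2 / Real.sqrt c := by positivity
  rcases le_total (g * δ) 1 with h | h
  · linarith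
  · have := le_self_pow₀ h (show d + 2 ≠ 0 by omega)
    linarith

theorem meshWidth_pow {d n : ℕ} {G : Subgroup (E d ≃ᵢ E d)} :
    meshWidth n G ^ (d + 2) = Real.log n / (n * Nat.card G) := by
  have h := Real.log_natCast_nonneg n
  rw [meshWidth, ← Real.rpow_natCast, ← Real.rpow_mul (by positivity)]
  push_cast
  rw [one_div_mul_cancel (by positivity), Real.rpow_one]

theorem rpow_mul_rpow_eq_mul_meshWidth {d n : ℕ} (hn : 2 ≤ n) {G : Subgroup (E d ≃ᵢ E d)} :
    (Real.log n / Nat.card G) ^ (1 / ((d : ℝ) + 2)) * (n : ℝ) ^ (((d : ℝ) + 1) / ((d : ℝ) + 2)) =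
      n * meshWidth n G := by
  have hn0 : (0 : ℝ) < n := by positivity
  have h := Real.log_natCast_nonneg n
  have he : ((d : ℝ) + 1) / (d + 2) = 1 - 1 / (d + 2) := by field_simp; ring
  rw [meshWidth, mul_comm (n : ℝ) (Nat.card G), ← div_div,
    Real.div_rpow (by positivity) hn0.le, he, Real.rpow_sub hn0, Real.rpow_one]
  ring

theorem rpow_mul_rpow_eq_inv_meshWidth_pow {d n : ℕ} {G : Subgroup (E d ≃ᵢ E d)} :
    ((Nat.card G : ℝ) / Real.log n) ^ ((d : ℝ) / ((d : ℝ) + 2)) *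
      (n : ℝ) ^ ((d : ℝ) / ((d : ℝ) + 2)) = (meshWidth n G ^ d)⁻¹ := by
  have h := Real.log_natCast_nonneg n
  rw [meshWidth, ← Real.rpow_natCast, ← Real.rpow_mul (by positivity), one_div_mul_eq_div,
    ← Real.inv_rpow (by positivity), inv_div, ← Real.mul_rpow (by positivity) (by positivity)]
  congr 1
  ring

theorem meshWidth_pos {d n : ℕ} (hn : 2 ≤ n) {G : Subgroup (E d ≃ᵢ E d)} [Finite G] :
    0 < meshWidth n G := by
  have : 0 < Real.log n := Real.log_pos (by exact_mod_cast hn)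
  have : 0 < Nat.card G := Nat.card_pos
  rw [meshWidth]
  positivity

theorem meshWidth_le_one {d n : ℕ} (hn : 2 ≤ n) {G : Subgroup (E d ≃ᵢ E d)} [Finite G] :
    meshWidth n G ≤ 1 := by
  have h := Real.log_natCast_nonneg n
  have hn0 : (0 : ℝ) < n := by positivity
  have hg : (1 : ℝ) ≤ Nat.card G := by exact_mod_cast (Nat.card_pos : 0 < Nat.card G)
  refine Real.rpow_le_one (by positivity) ?_ (by positivity)
  rw [div_le_one (by positivity)]
  have := Real.log_le_sub_one_of_pos hn0
  nlinarith

end InvariantBandit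

theorem theorem1 {d : ℕ} (X : Set (InvariantBandit.E d)) (hcompact : IsCompact X)
    (hconvex : Convex ℝ X) (hne : X.Nonempty) (c : ℝ) (hc : 0 < c) :
    ∃ a₁ : ℝ, 0 < a₁ ∧ ∃ a₂ : ℝ, 0 < a₂ ∧
      ∀ (G : Subgroup (InvariantBandit.E d ≃ᵢ InvariantBandit.E d)) [Finite G],
        G ≤ InvariantBandit.symmetryGroup X →
      ∀ P : InvariantBandit.E d → MeasureTheory.Measure ℝ,
        InvariantBandit.IsInvariantLipschitzBandit X G P →
      ∀ n : ℕ, 2 ≤ n → c * (Nat.card G : ℝ) ^ (2 * d + 2) ≤ n →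
      ∀ V : Finset (InvariantBandit.E d),
        InvariantBandit.IsNet X (InvariantBandit.meshWidth n G) V →
      ∀ (Ω : Type*) [MeasurableSpace Ω] (μ : MeasureTheory.Measure Ω)
        [MeasureTheory.IsProbabilityMeasure μ]
        (A : ℕ → Ω → InvariantBandit.E d) (Y : ℕ → Ω → ℝ),
        InvariantBandit.IsUniformMeshN μ P n V (InvariantBandit.meshWidth n G) G A Y →
        InvariantBandit.regret μ X P n A ≤
          a₁ * (Real.log n / Nat.card G) ^ (1 / ((d : ℝ) + 2))
              * (n : ℝ) ^ (((d : ℝ) + 1) / ((d : ℝ) + 2))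
            + a₂ * ((Nat.card G : ℝ) / Real.log n) ^ ((d : ℝ) / ((d : ℝ) + 2))
              * (n : ℝ) ^ ((d : ℝ) / ((d : ℝ) + 2)) := by
  obtain ⟨R₀, hR₀⟩ := hcompact.isBounded.exists_norm_le
  set R := max R₀ 0 with hRdef
  have hR0 : 0 ≤ R := le_max_right _ _
  have hR : ∀ x ∈ X, ‖x‖ ≤ R := fun x hx => (hR₀ x hx).trans (le_max_left _ _)
  set C := InvariantBandit.packingConst d R with hC
  have hC0 : 0 ≤ C := InvariantBandit.packingConst_nonneg d hR0
  set D := C * (2 + 2 / Real.sqrt c) with hD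
  have hD0 : 0 ≤ D := by positivity
  -- `D` bounds `|G| * |W| * δ ^ d`, and `2 * C` bounds `|V| * δ ^ d`; the final `1` only ensures
  -- positivity.
  refine ⟨5 + 4 * Real.sqrt (2 * D), by positivity, D + 2 * C + 1, by positivity, ?_⟩
  intro G _ hG P hP n hn hcn V hV Ω _ μ _ A Y hA
  have hδ := InvariantBandit.meshWidth_pos hn (G := G)
  have hδ1 := InvariantBandit.meshWidth_le_one hn (G := G)
  rw [mul_assoc, mul_assoc, InvariantBandit.rpow_mul_rpow_eq_mul_meshWidth hn,
    InvariantBandit.rpow_mul_rpow_eq_inv_meshWidth_pow]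
  have hδp := InvariantBandit.meshWidth_pow (n := n) (G := G)
  set δ := InvariantBandit.meshWidth n G
  have hn0 : (0 : ℝ) < n := by positivity
  have hg : (1 : ℝ) ≤ Nat.card G := by exact_mod_cast (Nat.card_pos : 0 < Nat.card G)
  have hδd : 0 < δ ^ d := by positivity
  obtain ⟨W, κ, hκW, hκ, hW⟩ :=
    InvariantBandit.exists_orbit_clique_cover hG hR0 hR hδ hδ1 V hV.subset
  have hWD : (Nat.card G : ℝ) * W.card * δ ^ d ≤ D := by
    refine hW.trans (mul_le_mul_of_nonneg_left ?_ hC0)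
    have := InvariantBandit.group_mul_width_le (by exact_mod_cast (by omega : 1 ≤ n))
      (by linarith) hc hcn hδp
    linarith
  have hWle : (W.card : ℝ) ≤ D * (δ ^ d)⁻¹ := by
    rw [← div_eq_mul_inv, le_div_iff₀ hδd]
    refine le_trans ?_ hWD
    gcongr
    exact le_mul_of_one_le_left (Nat.cast_nonneg _) hg
  have hVle : (V.card : ℝ) ≤ 2 * C * (δ ^ d)⁻¹ := by
    rw [← div_eq_mul_inv, le_div_iff₀ hδd]
    exact InvariantBandit.card_mul_pow_le_of_separated hR0 hδ hδ1 (fun v hv => hR v (hV.subset v hv))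
      hV.packing
  have hsqrt : Real.sqrt (2 * Real.log n) * Real.sqrt (W.card * n) ≤
      Real.sqrt (2 * D) * (n * δ) := by
    -- The choice of `δ` turns `2 * log n * |W| * n` into `2 * (|G| * |W| * δ ^ d) * (n * δ) ^ 2`:
    -- the factor `|G|` in the packing bound is used up exactly here.
    have hlog : Real.log n = δ ^ (d + 2) * (n * Nat.card G) := by
      rw [hδp]
      field_simp
    have hlog0 := Real.log_natCast_nonneg n
    rw [← Real.sqrt_mul (by positivity)]
    refine Real.sqrt_le_iff.2 ⟨by positivity, ?_⟩
    rw [mul_pow, Real.sq_sqrt (by positivity), hlog]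
    calc _ = 2 * ((Nat.card G : ℝ) * W.card * δ ^ d) * (n * δ) ^ 2 := by ring
      _ ≤ _ := by gcongr
  have hinv : 0 ≤ (δ ^ d)⁻¹ := by positivity
  have := hA.regret_le hne hG hP hn hδ hV hκW hκ
  nlinarith
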